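/- For integers $m,n\ge 0$ let $S_m$ be the set of rankings (linear orders) of $[m]=\{1,\dots,m\}$; a profile is a vector $R=(R_1,\dots,R_n)\in S_m^n$, and $a<_\pi b$ means that $a$ is preferred to $b$ in $\pi$. The CNF formula $\mathrm{Arrow}_{m,n}$ has a variable $X_{R,\pi}$ for each profile $R$ and each $\pi\in S_m$, and the clauses 1. $\bigvee_{\pi\in S_m}X_{R,\pi}$ for each $R$, and $\overline{X_{R,\pi_1}}\vee\overline{X_{R,\pi_2}}$ for each $R$ and $\pi_1\ne\pi_2$; 2. $\bigvee_{R}\overline{X_{R,R_i}}$ for $i=1,\dots,n$ (no agent is a dictator); 3. $\bigvee_{\pi:\,a<_\pi b}X_{R,\pi}$ for all $a\ne b$ and all $R$ with $a<_{R_i}b$ for every $i$ (unanimity); 4. $\overline{X_{R,\pi_1}}\vee\overline{X_{R',\pi_2}}$ for all $a,b$, all $R,R'$ in which each agent ranks $a,b$ in the same way, and all $\pi_1,\pi_2$ that rank $a,b$ in different ways (independence of irrelevant alternatives). $|\mathrm{Arrow}_{m,n}|$ is the number of symbols in these clauses. A Frege derivation is a sequence of propositional formulas, each of which is a hypothesis,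 an instance of one of the axiom schemes of a fixed textbook calculus for propositional logic, or follows from earlier ones by modus ponens. Its size is the total number of symbols. A Frege proof of $\mathrm{Arrow}_{m,n}$ is a Frege derivation of the constant false from its clauses. Consider the parameterized problem $L$ of all pairs $(m,n)$, with $m$ written in unary and with parameter $n$, such that $\mathrm{Arrow}_{m,n}$ is satisfiable. Consider two rules: (a) $(m,n)\mapsto(5,n)$ if $m\ge 6$; (b) $(m,n)\mapsto(m,n-1)$ if $m,n\ge 3$; each leaves all other instances unchanged. A reduction chain for $(m,n)$ is a sequence of instances that starts with $(m,n)$, in which each later instance arises from the previous one by a rule that changes it, and whose last instance is changed by neither rule; its length is its number of steps. **Theorem.** (i) Rules (a) and (b) are data reduction rules for $L$: they are computable in polynomial time, preserve membership in $L$, and do not increase the length of the word. There is a kernelization for $L$ which maps every instance to the end of a reduction chain for it: it is computable in polynomial time, preserves membership in $L$, and the word length and the parameter of the kernel are at most $g(n)$ for a computable function $g$. There is a constant $C$, independent of $m$ and $n$, such that every reduction chain for $(m,n)$ has length at most $C(n+1)$. (ii) The soundness of both rules is witnessed by polynomial-size Frege proofs. That is, there are a polynomial $h$ and, for each rule, a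 constant $r\geq 1$ such that the following holds for each application $(m_1,n_1)\mapsto(m_2,n_2)$ of the rule in a reduction chain for an instance $(m,n)\notin L$: there are $q\le r$ formulas $\Xi_1,\dots,\Xi_q$ in the variables of $\mathrm{Arrow}_{m_1,n_1}$, and substitutions $\sigma_1,\dots,\sigma_q$ of formulas in these variables for the variables of $\mathrm{Arrow}_{m_2,n_2}$, such that a Frege proof of $\Xi_1\vee\dots\vee\Xi_q$ and, for each $t$, a Frege derivation of all clauses of $\sigma_t(\mathrm{Arrow}_{m_2,n_2})$ from the clauses of $\mathrm{Arrow}_{m_1,n_1}$ and $\Xi_t$ exist with total size at most $h(|\mathrm{Arrow}_{m,n}|)$. (iii) There is a quasipolynomial function $f$, i.e. $f(N)=O\bigl(2^{c\log^k N}\bigr)$ for some constants $c$ and $k>0$, such that for all $m,n\ge 3$ the formula $\mathrm{Arrow}_{m,n}$ has a Frege proof of size at most $f(|\mathrm{Arrow}_{m,n}|)$. (iv) For every fixed $n\ge 3$ there is a polynomial $p_n$ such that for all $m\ge 3$ the formula $\mathrm{Arrow}_{m,n}$ has a Frege proof of size at most $p_n(|\mathrm{Arrow}_{m,n}|)$.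 -/

import Mathlib

namespace FregeArrow

/-! ### Propositional formulas and a textbook Frege system -/

/-- Propositional formulas over the set of variables `V`. -/
inductive PForm (V : Type) : Type
  | var : V → PForm V
  | falsum : PForm V
  | neg : PForm V → PForm V
  | and : PForm V → PForm V → PForm V
  | or : PForm V → PForm V → PForm V
  | imp : PForm V → PForm V → PForm V

namespace PForm

/-- The size of a formula: the number of symbols (variables, constants and connectives) in it. -/
def size {V : Type} : PForm V → ℕ
  | var _ => 1
  | falsum => 1
  | neg A => A.size + 1
  | and A B => A.size + B.size + 1
  | or A B => A.size + B.size + 1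
  | imp A B => A.size + B.size + 1

/-- Simultaneous substitution of formulas over `W` for the variables in `V`. -/
def subst {V W : Type} (σ : V → PForm W) : PForm V → PForm W
  | var x => σ x
  | falsum => falsum
  | neg A => neg (A.subst σ)
  | and A B => and (A.subst σ) (B.subst σ)
  | or A B => or (A.subst σ) (B.subst σ)
  | imp A B => imp (A.subst σ) (B.subst σ)

/-- The disjunction of a list of formulas; the empty disjunction is the constant `falsum`. -/
def disj {V : Type} : List (PForm V) → PForm V
  | [] => falsum
  | A :: l => or A (disj l)

end PForm

/-- The axiom schemes of the Frege system. -/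
inductive FregeAxiom {V : Type} : PForm V → Prop
  | k (A B : PForm V) : FregeAxiom (A.imp (B.imp A))
  | s (A B C : PForm V) :
      FregeAxiom ((A.imp (B.imp C)).imp ((A.imp B).imp (A.imp C)))
  | and_left (A B : PForm V) : FregeAxiom ((A.and B).imp A)
  | and_right (A B : PForm V) : FregeAxiom ((A.and B).imp B)
  | and_intro (A B : PForm V) : FregeAxiom (A.imp (B.imp (A.and B)))
  | or_inl (A B : PForm V) : FregeAxiom (A.imp (A.or B))
  | or_inr (A B : PForm V) : FregeAxiom (B.imp (A.or B))
  | or_elim (A B C : PForm V) :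
      FregeAxiom ((A.imp C).imp ((B.imp C).imp ((A.or B).imp C)))
  | neg_intro (A B : PForm V) :
      FregeAxiom ((A.imp B).imp ((A.imp B.neg).imp A.neg))
  | neg_neg (A : PForm V) : FregeAxiom (A.neg.neg.imp A)
  | falsum_elim (A : PForm V) : FregeAxiom (PForm.falsum.imp A)

/-- `FregeDerivation Γ d`: the list of lines `d`, written with the last line first, is a Frege
derivation from the set of hypotheses `Γ`. Every line is an instance of an axiom scheme, a
hypothesis, or follows from two earlier lines by modus ponens. -/
inductive FregeDerivation {V : Type} (Γ : Set (PForm V)) : List (PForm V) → Prop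
  | nil : FregeDerivation Γ []
  | ax {d : List (PForm V)} {A : PForm V} :
      FregeDerivation Γ d → FregeAxiom A → FregeDerivation Γ (A :: d)
  | hyp {d : List (PForm V)} {A : PForm V} :
      FregeDerivation Γ d → A ∈ Γ → FregeDerivation Γ (A :: d)
  | mp {d : List (PForm V)} {A B : PForm V} :
      FregeDerivation Γ d → A.imp B ∈ d → A ∈ d → FregeDerivation Γ (B :: d)

/-- The size of a derivation: the total number of symbols in its lines. -/
def derivationSize {V : Type} (d : List (PForm V)) : ℕ := (d.map PForm.size).sum

/-! ### CNF formulas -/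

/-- `(x, true)` is the literal `x`, and `(x, false)` is its negation. -/
abbrev Literal (V : Type) : Type := V × Bool

/-- A clause is a finite set of literals, read as their disjunction. -/
abbrev Clause (V : Type) : Type := Finset (Literal V)

/-- A CNF formula is a finite set of clauses, read as their conjunction. -/
abbrev CNF (V : Type) : Type := Finset (Clause V)

/-- A literal as a propositional formula. -/
def Literal.toForm {V : Type} (l : Literal V) : PForm V :=
  if l.2 then PForm.var l.1 else (PForm.var l.1).neg

/-- A clause as a propositional formula (with its literals in some fixed order). -/
noncomputable def Clause.toForm {V : Type} (c : Clause V) : PForm V :=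
  PForm.disj (c.toList.map Literal.toForm)

/-- The set of the clauses of a CNF formula, as propositional formulas. -/
def CNF.forms {V : Type} (Φ : CNF V) : Set (PForm V) :=
  {A | ∃ c ∈ Φ, A = Clause.toForm c}

/-- The size of a CNF formula: the total number of symbols in its clauses. -/
noncomputable def CNF.size {V : Type} (Φ : CNF V) : ℕ := ∑ c ∈ Φ, (Clause.toForm c).size

/-- Some truth assignment satisfies every clause. -/
def CNF.Satisfiable {V : Type} (Φ : CNF V) : Prop :=
  ∃ v : V → Bool, ∀ c ∈ Φ, ∃ l ∈ c, v l.1 = l.2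

/-- The CNF formula `Φ` has a Frege proof (of its unsatisfiability) of size at most `s`:
a Frege derivation of the constant `falsum` from the clauses of `Φ`. -/
def HasFregeProofOfSize {V : Type} (Φ : CNF V) (s : ℝ) : Prop :=
  ∃ d : List (PForm V),
    FregeDerivation (CNF.forms Φ) d ∧ PForm.falsum ∈ d ∧ (derivationSize d : ℝ) ≤ s

/-! ### Parameterized problems, data reduction, kernelization -/

/-- A parameterized problem over the alphabet `α` is a set of pairs `(x, k)`. -/
abbrev ParamProblem (α : Type) : Type := Set (List α × ℕ)

/-- The input string of a machine for the instance `(x, k)`: the word `x` followed by `k` in unary.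
Its length is `|x| + k`. -/
def encodeInstance {α : Type} (p : List α × ℕ) : List (Option α) :=
  p.1.map some ++ List.replicate p.2 none

/-- A map on instances that a Turing machine computes in polynomial time. -/
def PolyTimeMap {α : Type} (A : List α × ℕ → List α × ℕ) : Prop :=
  Nonempty (Turing.TM2ComputableInPolyTime
    (encodeInstance (α := α)) (encodeInstance (α := α)) A)

/-- `A` is a data reduction rule for `L`. -/
structure IsDataReductionRule {α : Type} (L : ParamProblem α)
    (A : List α × ℕ → List α × ℕ) : Prop where
  polyTime : PolyTimeMap A
  safe : ∀ p, p ∈ L ↔ A p ∈ L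
  length_le : ∀ p, (A p).1.length ≤ p.1.length

/-- `Ker` is a kernelization for `L`. -/
structure IsKernelization {α : Type} (L : ParamProblem α)
    (Ker : List α × ℕ → List α × ℕ) : Prop where
  polyTime : PolyTimeMap Ker
  safe : ∀ p, p ∈ L ↔ Ker p ∈ L
  kernel_size : ∃ g : ℕ → ℕ, Computable g ∧
    ∀ p, (Ker p).1.length ≤ g p.2 ∧ (Ker p).2 ≤ g p.2

/-- `s 0, s 1, …, s l` is a data reduction chain of length `l` for the instance `p`: it starts at
`p`, every step is an application of one of the rules that changes the instance, and no rule
changes the last instance. (The values of `s` beyond `l` are irrelevant.) -/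
structure IsReductionChain {α : Type} (rules : List (List α × ℕ → List α × ℕ))
    (p : List α × ℕ) (l : ℕ) (s : ℕ → List α × ℕ) : Prop where
  initial : s 0 = p
  step : ∀ i < l, s (i + 1) ≠ s i ∧ ∃ A ∈ rules, s (i + 1) = A (s i)
  final : ∀ A ∈ rules, A (s l) = s l

/-- `Ker` is a kernelization for `L` via the data reduction rules in the given list: it maps every
instance to the end of a data reduction chain. -/
structure IsKernelizationVia {α : Type} (L : ParamProblem α)
    (rules : List (List α × ℕ → List α × ℕ)) (Ker : List α × ℕ → List α × ℕ) : Prop where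
  isRule : ∀ A ∈ rules, IsDataReductionRule L A
  isKernelization : IsKernelization L Ker
  exists_chain : ∀ p, ∃ l s, IsReductionChain rules p l s ∧ s l = Ker p

/-- The reduction step from `Φ₁` to `Φ₂` is witnessed by Frege proofs of total size at most `S`,
with at most `r` cases. There are `q ≤ r` case conditions `Ξ t` in the variables of `Φ₁`, a Frege
proof of their disjunction and, for each case, a substitution `σ t` of formulas in the variables of
`Φ₁` for those of `Φ₂` and a Frege derivation of all the substituted clauses of `Φ₂` from the
clauses of `Φ₁` and the case condition. -/
def StepHasFregeProofs {V W : Type} (Φ₁ : CNF V) (Φ₂ : CNF W) (r S : ℕ) : Prop :=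
  ∃ q ≤ r, ∃ (Ξ : Fin q → PForm V) (σ : Fin q → W → PForm V)
    (d₀ : List (PForm V)) (d : Fin q → List (PForm V)),
    FregeDerivation ∅ d₀ ∧ PForm.disj (List.ofFn Ξ) ∈ d₀ ∧
    (∀ t, FregeDerivation (CNF.forms Φ₁ ∪ {Ξ t}) (d t) ∧
      ∀ c ∈ Φ₂, (Clause.toForm c).subst (σ t) ∈ d t) ∧
    derivationSize d₀ + ∑ t, derivationSize (d t) ≤ S

/-- The soundness of the rule `A` (one of the given rules for `L`) has Frege proofs of size `h`,
where `Φ` translates instances of `L` into CNF formulas: with a number of cases bounded by a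
constant `r`, each application of `A` in a data reduction chain for a negative instance `p` is
witnessed by Frege proofs of total size at most `h |Φ p|`. -/
def SoundnessHasFregeProofs {α : Type} (L : ParamProblem α) {V : List α × ℕ → Type}
    (Φ : (p : List α × ℕ) → CNF (V p)) (rules : List (List α × ℕ → List α × ℕ))
    (A : List α × ℕ → List α × ℕ) (h : ℕ → ℕ) : Prop :=
  ∃ r : ℕ, 1 ≤ r ∧ ∀ p ∉ L, ∀ l s, IsReductionChain rules p l s →
    ∀ i < l, s (i + 1) = A (s i) →
      StepHasFregeProofs (Φ (s i)) (Φ (s (i + 1))) r (h (CNF.size (Φ p)))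

/-- `f` is quasipolynomial: `f(N) = O(2 ^ (c (log N) ^ k))` for some constants `k > 0` and `c`. -/
def IsQuasipolynomial (f : ℕ → ℝ) : Prop :=
  ∃ (k : ℕ) (c : ℝ), 0 < k ∧
    f =O[Filter.atTop] fun N : ℕ => (2 : ℝ) ^ (c * Real.log (N : ℝ) ^ k)

/-! ### The formulas expressing Arrow's theorem -/

/-- A ranking of `m` objects: `π i` is the object in position `i`. -/
abbrev Ranking (m : ℕ) : Type := Equiv.Perm (Fin m)

/-- A profile: a ranking for each of the `n` agents. -/
abbrev Profile (m n : ℕ) : Type := Fin n → Ranking m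

/-- `a` is preferred to `b` in `π`; preferred objects have lower positions. -/
abbrev Prefers {m : ℕ} (π : Ranking m) (a b : Fin m) : Prop := π.symm a < π.symm b

/-- The variable `(R, π)` says that the profile `R` is aggregated to the ranking `π`. -/
abbrev ArrowVar (m n : ℕ) : Type := Profile m n × Ranking m

/-- The clauses of the Arrow formula for `m` objects and `n` agents. -/
inductive IsArrowClause (m n : ℕ) : Clause (ArrowVar m n) → Prop
  /-- Every profile is aggregated to some ranking. -/
  | total (R : Profile m n) :
      IsArrowClause m n (Finset.univ.image fun π : Ranking m => ((R, π), true))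
  /-- No profile is aggregated to two different rankings. -/
  | unique (R : Profile m n) (π₁ π₂ : Ranking m) : π₁ ≠ π₂ →
      IsArrowClause m n {((R, π₁), false), ((R, π₂), false)}
  /-- Agent `i` is not a dictator. -/
  | nondictatorial (i : Fin n) :
      IsArrowClause m n (Finset.univ.image fun R : Profile m n => ((R, R i), false))
  /-- Unanimity. -/
  | unanimous (a b : Fin m) (R : Profile m n) : a ≠ b → (∀ i, Prefers (R i) a b) →
      IsArrowClause m n
        ((Finset.univ.filter fun π : Ranking m => Prefers π a b).image
          fun π => ((R, π), true))
  /-- Independence of irrelevant alternatives. -/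
  | iia (a b : Fin m) (R R' : Profile m n) (π₁ π₂ : Ranking m) :
      (∀ i, Prefers (R i) a b ↔ Prefers (R' i) a b) →
      (Prefers π₁ a b ∧ Prefers π₂ b a ∨ Prefers π₁ b a ∧ Prefers π₂ a b) →
      IsArrowClause m n {((R, π₁), false), ((R', π₂), false)}

open Classical in
/-- The Arrow formula for `m` objects and `n` agents: the set of all its clauses. -/
noncomputable def arrowFormula (m n : ℕ) : CNF (ArrowVar m n) :=
  Finset.univ.filter (IsArrowClause m n)

/-- An instance consists of the number `m` of objects, written in unary (so `m` is the length of
the word), and the number `n` of agents, which is the parameter. -/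
noncomputable def arrowTranslation (p : List Unit × ℕ) : CNF (ArrowVar p.1.length p.2) :=
  arrowFormula p.1.length p.2

/-- The parameterized problem of the Arrow formulas: the negative instances are those with an
unsatisfiable formula. -/
def arrowProblem : ParamProblem Unit :=
  {p | CNF.Satisfiable (arrowTranslation p)}

/-- First rule: reduce `m ≥ 6` objects to `5`. -/
def reduceObjects (p : List Unit × ℕ) : List Unit × ℕ :=
  if 6 ≤ p.1.length then (List.replicate 5 (), p.2) else p

/-- Second rule: for `m, n ≥ 3`, remove one agent. -/
def removeAgent (p : List Unit × ℕ) : List Unit × ℕ :=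
  if 3 ≤ p.1.length ∧ 3 ≤ p.2 then (p.1, p.2 - 1) else p

end FregeArrow

open FregeArrow

namespace FregeArrow

/-! The core is a formalised proof of Arrow's theorem by decisive coalitions. S is decisive for a
against b if the outcome prefers a to b when exactly the members of S do; by independence the choice
of such a profile is irrelevant. The workhorse is `ArrowContext.decisive_trans`: if S is decisive
for a against b and S' for b against c, then every coalition between S ∩ S' and S ∪ S' is decisive
for a against c, because each agent can be given a ranking with the prescribed comparisons and the
outcome is transitive. So decisiveness does not depend on the pair, passes to supersets
(`ArrowContext.decisive_neutral`) and to intersections (`ArrowContext.decisive_inter`), and a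
decisive singleton is a dictator.

The refutation visits only a chain of n + 1 coalitions: the empty one is not decisive, one more
agent cannot make a non-decisive coalition decisive, yet unanimity makes the set of all agents
decisive. Each step costs a fixed power of the number m!^(n+1) of variables, which is at most the
size of the formula. This yields Frege proofs of polynomial size with an exponent independent of m
and n (`arrowFormula_hasFregeProof`), hence both size bounds. By soundness of the calculus the
formulas with m ≥ 3 are unsatisfiable, which makes the rules and the kernelization safe.

For the Frege witnesses of the rules, an aggregation rule of the large society is turned into one of
the small society (`SocietyMap`). Its properties carry over (`ArrowContext.simulation`) except that
the agents represented by one voter must not be jointly decisive. For fewer objects these agents are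
a single one. To remove an agent, agents 0 and 1 or agents 1 and 2 are merged; one of these pairs is
not decisive, since otherwise their intersection {1} would be.

Polynomial time holds because two passes with bounded counters suffice. Chains are short since every
step lowers `remainingSteps`, and they end in `arrowKernel`, which no rule changes. -/

/-! ### Two-pass transducers as stack machines -/

/-- The machine that moves its input to an auxiliary stack while updating its state by `f`, and then
moves it back while updating its state by `g`, keeping only the symbols `a` with `e s a`, where `s`
is the updated state. -/
def twoPassMachine {A S : Type} [Fintype A] [Fintype S] [Inhabited A]
    (s₀ : S) (f g : S → A → S) (e : S → A → Bool) : Turing.FinTM2 where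
  K := Bool
  k₀ := true
  k₁ := true
  Γ _ := A
  Λ := Bool
  main := false
  σ := S × Option A
  initialState := (s₀, none)
  m
    | false => .pop true (fun v x => (x.elim v.1 (f v.1), x))
        (.branch (fun v => v.2.isSome)
          (.push false (fun v => v.2.getD default) (.goto fun _ => false))
          (.goto fun _ => true))
    | true => .pop false (fun v x => (x.elim v.1 (g v.1), x))
        (.branch (fun v => v.2.isSome)
          (.branch (fun v => e v.1 (v.2.getD default))
            (.push true (fun v => v.2.getD default) (.goto fun _ => true))
            (.goto fun _ => true))
          -- A halting configuration has to carry the initial internal state, so it is restored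
          -- here.
          (.load (fun _ => (s₀, none)) .halt))

/-- One step of the second pass, on the state and the output. -/
def secondPass {A S : Type} (g : S → A → S) (e : S → A → Bool) (p : S × List A) (a : A) :
    S × List A :=
  (g p.1 a, if e (g p.1 a) a then a :: p.2 else p.2)

section TwoPass

variable {A S : Type} [Fintype A] [Fintype S] [Inhabited A]
  (s₀ : S) (f g : S → A → S) (e : S → A → Bool)

/-- The configurations of the machine `twoPassMachine`. -/
def twoPassCfg (l : Option Bool) (v : S × Option A) (x y : List A) :
    (twoPassMachine s₀ f g e).Cfg :=
  ⟨l, v, fun k : Bool => (cond k x y : List A)⟩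

/-- A machine step produces stacks through `Function.update`; they are compared with the `cond` form
stack by stack, where each equality holds by computation. -/
theorem twoPassCfg_eq {l : Option Bool} {v : S × Option A} {x y : List A}
    {stk : Bool → List A} (h₁ : stk true = x) (h₂ : stk false = y) :
    (⟨l, v, stk⟩ : (twoPassMachine s₀ f g e).Cfg) = twoPassCfg s₀ f g e l v x y := by
  unfold twoPassCfg
  congr 1
  funext k
  cases k <;> simp [h₁, h₂]

theorem step_firstPass_cons (v : S × Option A) (a : A) (x y : List A) :
    (twoPassMachine s₀ f g e).step (twoPassCfg s₀ f g e (some false) v (a :: x) y) =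
      some (twoPassCfg s₀ f g e (some false) (f v.1 a, some a) x (a :: y)) :=
  congrArg some (twoPassCfg_eq s₀ f g e rfl rfl)

theorem step_firstPass_nil (v : S × Option A) (y : List A) :
    (twoPassMachine s₀ f g e).step (twoPassCfg s₀ f g e (some false) v [] y) =
      some (twoPassCfg s₀ f g e (some true) (v.1, none) [] y) :=
  congrArg some (twoPassCfg_eq s₀ f g e rfl rfl)

theorem step_secondPass_cons (v : S × Option A) (a : A) (x y : List A) :
    (twoPassMachine s₀ f g e).step (twoPassCfg s₀ f g e (some true) v x (a :: y)) =
      some (twoPassCfg s₀ f g e (some true) ((secondPass g e (v.1, x) a).1, some a)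
        (secondPass g e (v.1, x) a).2 y) := by
  have key : (twoPassMachine s₀ f g e).step (twoPassCfg s₀ f g e (some true) v x (a :: y)) =
      some (cond (e (g v.1 a) a)
        (twoPassCfg s₀ f g e (some true) (g v.1 a, some a) (a :: x) y)
        (twoPassCfg s₀ f g e (some true) (g v.1 a, some a) x y)) := by
    exact congrArg some (congrArg₂ (cond (e (g v.1 a) a))
      (twoPassCfg_eq s₀ f g e (stk := Function.update (Function.update
        (fun k : Bool => (cond k x (a :: y) : List A)) false y) true (a :: x)) rfl rfl)
      (twoPassCfg_eq s₀ f g e (stk := Function.update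
        (fun k : Bool => (cond k x (a :: y) : List A)) false y) rfl rfl))
  rw [key]
  unfold secondPass
  cases e (g v.1 a) a <;> simp

theorem step_secondPass_nil (v : S × Option A) (x : List A) :
    (twoPassMachine s₀ f g e).step (twoPassCfg s₀ f g e (some true) v x []) =
      some (twoPassCfg s₀ f g e none (s₀, none) x []) :=
  congrArg some (twoPassCfg_eq s₀ f g e rfl rfl)

theorem iterate_firstPass (x : List A) (v : S × Option A) (y : List A) :
    (flip bind (twoPassMachine s₀ f g e).step)^[x.length + 1]
        (some (twoPassCfg s₀ f g e (some false) v x y)) =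
      some (twoPassCfg s₀ f g e (some true) (x.foldl f v.1, none) [] (x.reverse ++ y)) := by
  induction x generalizing v y with
  | nil => exact step_firstPass_nil s₀ f g e v y
  | cons a x ih =>
    rw [List.length_cons, Function.iterate_succ_apply]
    have : flip bind (twoPassMachine s₀ f g e).step
        (some (twoPassCfg s₀ f g e (some false) v (a :: x) y)) =
        some (twoPassCfg s₀ f g e (some false) (f v.1 a, some a) x (a :: y)) :=
      step_firstPass_cons s₀ f g e v a x y
    rw [this, ih]
    simp

theorem iterate_secondPass (y : List A) (v : S × Option A) (x : List A) :
    (flip bind (twoPassMachine s₀ f g e).step)^[y.length + 1]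
        (some (twoPassCfg s₀ f g e (some true) v x y)) =
      some (twoPassCfg s₀ f g e none (s₀, none) (y.foldl (secondPass g e) (v.1, x)).2 []) := by
  induction y generalizing v x with
  | nil => exact step_secondPass_nil s₀ f g e v x
  | cons a y ih =>
    rw [List.length_cons, Function.iterate_succ_apply]
    have : flip bind (twoPassMachine s₀ f g e).step
        (some (twoPassCfg s₀ f g e (some true) v x (a :: y))) =
        some (twoPassCfg s₀ f g e (some true) ((secondPass g e (v.1, x) a).1, some a)
        (secondPass g e (v.1, x) a).2 y) :=
      step_secondPass_cons s₀ f g e v a x y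
    rw [this, ih]
    simp

/-- Each pass takes one step per symbol and one more to notice the empty stack. The second pass
reads the word backwards and pushes the kept symbols, which restores their order. -/
theorem twoPass_polyTime {α β : Type} (ea : α → List A) (eb : β → List A) (F : α → β)
    (h : ∀ p, (((ea p).reverse).foldl (secondPass g e) ((ea p).foldl f s₀, [])).2 = eb (F p)) :
    Nonempty (Turing.TM2ComputableInPolyTime ea eb F) := by
  refine ⟨⟨⟨twoPassMachine s₀ f g e, Equiv.refl _, Equiv.refl _⟩,
    Polynomial.C 2 * Polynomial.X + Polynomial.C 2, fun p =>
    ⟨⟨(ea p).length + 1 + ((ea p).length + 1), ?_⟩, ?_⟩⟩⟩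
  · have h₁ : Turing.initList (twoPassMachine s₀ f g e) (ea p) =
        twoPassCfg s₀ f g e (some false) (s₀, none) (ea p) [] :=
      twoPassCfg_eq s₀ f g e rfl rfl
    have h₂ : Turing.haltList (twoPassMachine s₀ f g e) (eb (F p)) =
        twoPassCfg s₀ f g e none (s₀, none) (eb (F p)) [] :=
      twoPassCfg_eq s₀ f g e rfl rfl
    have e₁ : ∀ l : List A, List.map (Equiv.refl A).invFun l = l := fun l => List.map_id l
    have e₂ := iterate_firstPass s₀ f g e (ea p) (s₀, none) []
    have e₃ := iterate_secondPass s₀ f g e (ea p).reverse ((ea p).foldl f s₀, none) []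
    rw [h, List.length_reverse] at e₃
    rw [List.append_nil] at e₂
    have goal' : (flip bind (twoPassMachine s₀ f g e).step)^[
        (ea p).length + 1 + ((ea p).length + 1)]
        (some (Turing.initList (twoPassMachine s₀ f g e) (ea p))) =
        some (Turing.haltList (twoPassMachine s₀ f g e) (eb (F p))) := by
      rw [h₁, h₂, Function.iterate_add_apply, e₂, e₃]
    have e₁' := e₁ (ea p)
    have e₁'' := e₁ (eb (F p))
    convert goal' using 3
    · exact congrArg (fun l => Turing.initList (twoPassMachine s₀ f g e) l) e₁'
    · exact congrArg (fun l => some (Turing.haltList (twoPassMachine s₀ f g e) l)) e₁''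
  · simp
    omega

end TwoPass

/-! ### The rules and the kernelization are computable in polynomial time -/

/-- The number `x`, cut off at `k`. -/
def cap (k x : ℕ) : Fin (k + 1) := ⟨min x k, by omega⟩

/-- Counting commutes with the cut-off, so finitely many states hold the counter. -/
theorem cap_succ (k x : ℕ) : cap k ((cap k x : ℕ) + 1) = cap k (x + 1) := by
  ext
  simp only [cap]
  omega

/-- Cut-off counters for the letters and the unary parameter symbols read so far. -/
def countSymbol (c : Fin 7 × Fin 4) : Option Unit → Fin 7 × Fin 4
  | none => (c.1, cap 3 (c.2 + 1))
  | some _ => (cap 6 (c.1 + 1), c.2)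

/-- Update of the counters of the first pass. -/
def countFirst (s : (Fin 7 × Fin 4) × (Fin 7 × Fin 4)) (a : Option Unit) :
    (Fin 7 × Fin 4) × (Fin 7 × Fin 4) :=
  (countSymbol s.1 a, s.2)

/-- Update of the counters of the second pass. -/
def countSecond (s : (Fin 7 × Fin 4) × (Fin 7 × Fin 4)) (a : Option Unit) :
    (Fin 7 × Fin 4) × (Fin 7 × Fin 4) :=
  (s.1, countSymbol s.2 a)

/-- Whether a symbol is kept, in terms of the counters. -/
def keepSymbol (e₁ : Fin 7 × Fin 4 → Fin 7 → Bool) (e₂ : Fin 7 × Fin 4 → Fin 4 → Bool)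
    (s : (Fin 7 × Fin 4) × (Fin 7 × Fin 4)) : Option Unit → Bool
  | none => e₂ s.1 s.2.2
  | some _ => e₁ s.1 s.2.1

theorem encodeInstance_unit (p : List Unit × ℕ) :
    encodeInstance p = List.replicate p.1.length (some ()) ++ List.replicate p.2 none := by
  unfold encodeInstance
  congr 1
  rw [List.eq_replicate_iff]
  simp

theorem foldl_countFirst_some (m : ℕ) (d : Fin 7 × Fin 4) :
    (List.replicate m (some ())).foldl countFirst ((cap 6 0, cap 3 0), d) =
      ((cap 6 m, cap 3 0), d) := by
  induction m with
  | zero => rfl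
  | succ m ih =>
    rw [List.replicate_succ', List.foldl_append, ih]
    simp [countFirst, countSymbol, cap_succ]

theorem foldl_countFirst_none (m n : ℕ) (d : Fin 7 × Fin 4) :
    (List.replicate n (none : Option Unit)).foldl countFirst ((cap 6 m, cap 3 0), d) =
      ((cap 6 m, cap 3 n), d) := by
  induction n with
  | zero => rfl
  | succ n ih =>
    rw [List.replicate_succ', List.foldl_append, ih]
    simp [countFirst, countSymbol, cap_succ]

theorem foldl_secondPass_none (e₁ : Fin 7 × Fin 4 → Fin 7 → Bool)
    (e₂ : Fin 7 × Fin 4 → Fin 4 → Bool) (c : Fin 7 × Fin 4) (n : ℕ) :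
    (List.replicate n (none : Option Unit)).foldl (secondPass countSecond (keepSymbol e₁ e₂))
        ((c, (cap 6 0, cap 3 0)), []) =
      ((c, (cap 6 0, cap 3 n)),
        List.replicate (Nat.count (fun i => e₂ c (cap 3 (i + 1))) n) none) := by
  induction n with
  | zero => simp
  | succ n ih =>
    rw [List.replicate_succ', List.foldl_append, ih, Nat.count_succ]
    cases h : e₂ c (cap 3 (n + 1)) <;>
      simp [secondPass, countSecond, countSymbol, keepSymbol, cap_succ, h, List.replicate_succ]

theorem foldl_secondPass_some (e₁ : Fin 7 × Fin 4 → Fin 7 → Bool)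
    (e₂ : Fin 7 × Fin 4 → Fin 4 → Bool) (c : Fin 7 × Fin 4) (d : Fin 4) (m : ℕ)
    (l : List (Option Unit)) :
    (List.replicate m (some ())).foldl (secondPass countSecond (keepSymbol e₁ e₂))
        ((c, (cap 6 0, d)), l) =
      ((c, (cap 6 m, d)),
        List.replicate (Nat.count (fun i => e₁ c (cap 6 (i + 1))) m) (some ()) ++ l) := by
  induction m with
  | zero => simp
  | succ m ih =>
    rw [List.replicate_succ', List.foldl_append, ih, Nat.count_succ]
    cases h : e₁ c (cap 6 (m + 1)) <;>
      simp [secondPass, countSecond, countSymbol, keepSymbol, cap_succ, h, List.replicate_succ]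

/-- The first pass learns the cut-off values of m and n; the second decides on each symbol from
these and from its cut-off running number among symbols of its kind. Symbols of one kind are
indistinguishable, so only how many are kept matters. -/
theorem polyTimeMap_of_count (e₁ : Fin 7 × Fin 4 → Fin 7 → Bool)
    (e₂ : Fin 7 × Fin 4 → Fin 4 → Bool) (F : List Unit × ℕ → List Unit × ℕ)
    (h₁ : ∀ p, Nat.count (fun i => e₁ (cap 6 p.1.length, cap 3 p.2) (cap 6 (i + 1))) p.1.length =
      (F p).1.length)
    (h₂ : ∀ p, Nat.count (fun i => e₂ (cap 6 p.1.length, cap 3 p.2) (cap 3 (i + 1))) p.2 =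
      (F p).2) :
    PolyTimeMap F := by
  refine twoPass_polyTime ((cap 6 0, cap 3 0), (cap 6 0, cap 3 0)) countFirst countSecond
    (keepSymbol e₁ e₂) _ _ F fun p => ?_
  rw [encodeInstance_unit, encodeInstance_unit, List.reverse_append, List.reverse_replicate,
    List.reverse_replicate, List.foldl_append, List.foldl_append, foldl_countFirst_some,
    foldl_countFirst_none, foldl_secondPass_none, foldl_secondPass_some, h₁, h₂]

theorem count_lt_eq_min (k n : ℕ) : Nat.count (fun i => i < k) n = min n k := by
  induction n with
  | zero => simp
  | succ n ih => rw [Nat.count_succ, ih]; split_ifs <;> omega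

theorem count_true_eq (n : ℕ) (p : ℕ → Prop) [DecidablePred p] (h : ∀ i, p i) :
    Nat.count p n = n := by
  induction n with
  | zero => simp
  | succ n ih => rw [Nat.count_succ, ih, if_pos (h n)]

theorem count_pos_eq (n : ℕ) : Nat.count (fun i => 0 < i) n = n - 1 := by
  induction n with
  | zero => simp
  | succ n ih => rw [Nat.count_succ, ih]; split_ifs <;> omega

theorem polyTimeMap_reduceObjects : PolyTimeMap reduceObjects := by
  -- A counter value 6 means at least six letters; the running number is below the cut-off exactly
  -- for the first five letters met.
  refine polyTimeMap_of_count (fun c d => decide (c.1 = 6 → d ≠ 6)) (fun _ _ => true) _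
    (fun p => ?_) (fun p => ?_)
  · unfold reduceObjects
    split_ifs with h
    · rw [List.length_replicate, ← min_eq_right (show 5 ≤ p.1.length by omega),
        ← count_lt_eq_min]
      congr 1
      funext i
      simp only [Fin.ext_iff, cap, decide_eq_true_eq, ne_eq, eq_iff_iff]
      norm_num
      omega
    · refine count_true_eq _ _ fun i => ?_
      simp only [Fin.ext_iff, cap, decide_eq_true_eq, ne_eq]
      norm_num
      omega
  · rw [count_true_eq _ _ fun _ => rfl]
    unfold reduceObjects
    split_ifs <;> rfl

theorem polyTimeMap_removeAgent : PolyTimeMap removeAgent := by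
  -- A single parameter symbol is dropped, the one with running number 1; the value 3 of the first
  -- counter for agents means at least three.
  refine polyTimeMap_of_count (fun _ _ => true)
    (fun c d => decide (3 ≤ (c.1 : ℕ) → (c.2 : ℕ) = 3 → (d : ℕ) ≠ 1)) _
    (fun p => ?_) (fun p => ?_)
  · rw [count_true_eq _ _ fun _ => rfl]
    unfold removeAgent
    split_ifs <;> rfl
  · unfold removeAgent
    split_ifs with h
    · rw [← count_pos_eq]
      congr 1
      funext i
      rw [decide_eq_true_eq]
      simp only [cap, ne_eq, eq_iff_iff]
      omega
    · refine count_true_eq _ _ fun i => ?_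
      rw [decide_eq_true_eq]
      simp only [cap, ne_eq]
      omega

/-- The end of all reduction chains: at most `5` objects and at most `2` agents if there are at
least `3` objects. -/
def arrowKernel (p : List Unit × ℕ) : List Unit × ℕ :=
  if 3 ≤ p.1.length then (List.replicate (min p.1.length 5) (), min p.2 2) else p

theorem polyTimeMap_arrowKernel : PolyTimeMap arrowKernel := by
  refine polyTimeMap_of_count (fun c d => decide (3 ≤ (c.1 : ℕ) → (d : ℕ) ≤ 5))
    (fun c d => decide (3 ≤ (c.1 : ℕ) → (d : ℕ) ≤ 2)) _
    (fun p => ?_) (fun p => ?_)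
  · unfold arrowKernel
    split_ifs with h
    · rw [List.length_replicate, ← count_lt_eq_min]
      congr 1
      funext i
      rw [decide_eq_true_eq]
      simp only [cap, eq_iff_iff]
      omega
    · refine count_true_eq _ _ fun i => ?_
      rw [decide_eq_true_eq]
      simp only [cap]
      omega
  · unfold arrowKernel
    split_ifs with h
    · refine Eq.trans ?_ (count_lt_eq_min 2 p.2)
      congr 1
      funext i
      rw [decide_eq_true_eq]
      simp only [cap, eq_iff_iff]
      omega
    · refine count_true_eq _ _ fun i => ?_
      rw [decide_eq_true_eq]
      simp only [cap]
      omega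

/-! ### Frege derivations with bounds on the number and the size of the lines -/

section Frege

variable {V W : Type} {Γ Δ : Set (PForm V)} {A B C : PForm V} {L L₁ L₂ b b' : ℕ}

theorem FregeDerivation.append {d₁ d₂ : List (PForm V)} (h₁ : FregeDerivation Γ d₁)
    (h₂ : FregeDerivation Γ d₂) : FregeDerivation Γ (d₁ ++ d₂) := by
  induction h₁ with
  | nil => exact h₂
  | ax _ hA ih => exact ih.ax hA
  | hyp _ hA ih => exact ih.hyp hA
  | mp _ h h' ih => exact ih.mp (List.mem_append_left _ h) (List.mem_append_left _ h')

theorem FregeDerivation.mono {d : List (PForm V)} (h : FregeDerivation Γ d) (hΓ : Γ ⊆ Δ) :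
    FregeDerivation Δ d := by
  induction h with
  | nil => exact .nil
  | ax _ hA ih => exact ih.ax hA
  | hyp _ hA ih => exact ih.hyp (hΓ hA)
  | mp _ h h' ih => exact ih.mp h h'

/-- There is a Frege derivation of `A` from `Γ` with at most `L` lines of size at most `b`. -/
def Der (Γ : Set (PForm V)) (L b : ℕ) (A : PForm V) : Prop :=
  ∃ d : List (PForm V), FregeDerivation Γ d ∧ A ∈ d ∧ d.length ≤ L ∧ ∀ B ∈ d, B.size ≤ b

namespace Der

theorem mono (h : Der Γ L b A) (hΓ : Γ ⊆ Δ) (hL : L ≤ L₁) (hb : b ≤ b') : Der Δ L₁ b' A := by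
  obtain ⟨d, hd, hA, hl, hs⟩ := h
  exact ⟨d, hd.mono hΓ, hA, hl.trans hL, fun B hB => (hs B hB).trans hb⟩

theorem size_le (h : Der Γ L b A) : A.size ≤ b := by
  obtain ⟨d, -, hA, -, hs⟩ := h
  exact hs A hA

theorem ax (h : FregeAxiom A) (hb : A.size ≤ b) : Der Γ 1 b A :=
  ⟨[A], FregeDerivation.nil.ax h, by simp, by simp, by simpa using hb⟩

theorem hyp (h : A ∈ Γ) (hb : A.size ≤ b) : Der Γ 1 b A :=
  ⟨[A], FregeDerivation.nil.hyp h, by simp, by simp, by simpa using hb⟩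

theorem mp (h₁ : Der Γ L₁ b (A.imp B)) (h₂ : Der Γ L₂ b A) : Der Γ (L₁ + L₂ + 1) b B := by
  have hB := h₁.size_le
  obtain ⟨d₁, hd₁, hA₁, hl₁, hs₁⟩ := h₁
  obtain ⟨d₂, hd₂, hA₂, hl₂, hs₂⟩ := h₂
  refine ⟨B :: (d₁ ++ d₂), (hd₁.append hd₂).mp (List.mem_append_left _ hA₁)
    (List.mem_append_right _ hA₂), by simp, by simp; omega, fun D hD => ?_⟩
  rcases List.mem_cons.1 hD with rfl | hD
  · simp only [PForm.size] at hB
    omega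
  · rcases List.mem_append.1 hD with hD | hD
    exacts [hs₁ D hD, hs₂ D hD]

theorem imp_self (hb : 9 * A.size + 8 ≤ b) : Der Γ 5 b (A.imp A) := by
  refine ((Der.ax (FregeAxiom.s A (A.imp A) A) ?_).mp
    (Der.ax (FregeAxiom.k A (A.imp A)) ?_)).mp (Der.ax (FregeAxiom.k A A) ?_)
  all_goals simp only [PForm.size]; omega

/-- Every line B becomes at most five lines ending in A → B: five if B is A itself, three for any
other hypothesis, an axiom or a modus ponens. The summand 9|A| + 8 is the size of the largest axiom
used for A → A. -/
theorem deduction (h : Der (insert A Γ) L b B) (hb : 9 * A.size + 3 * b + 8 ≤ b') :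
    Der Γ (5 * L) b' (A.imp B) := by
  obtain ⟨d, hd, hB, hl, hs⟩ := h
  -- All lines are translated together, so that a line used several times is not copied.
  have key : ∀ d : List (PForm V), FregeDerivation (insert A Γ) d → (∀ B ∈ d, B.size ≤ b) →
      ∃ d' : List (PForm V), FregeDerivation Γ d' ∧ (∀ B ∈ d, A.imp B ∈ d') ∧
        d'.length ≤ 5 * d.length ∧ ∀ B ∈ d', B.size ≤ b' := by
    intro d hd
    have cons : ∀ {d d' : List (PForm V)} {B : PForm V}, (∀ B ∈ d, A.imp B ∈ d') →
        d'.length ≤ 5 * d.length → FregeDerivation Γ d' → (∀ B ∈ d', B.size ≤ b') →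
        Der Γ 5 b' (A.imp B) →
        ∃ d'' : List (PForm V), FregeDerivation Γ d'' ∧ (∀ D ∈ B :: d, A.imp D ∈ d'') ∧
          d''.length ≤ 5 * (B :: d).length ∧ ∀ B ∈ d'', B.size ≤ b' := by
      rintro d d' B h₁ h₂ h₃ h₄ ⟨e, he, hBe, hle, hse⟩
      refine ⟨e ++ d', he.append h₃, fun D hD => ?_, by simp; omega, fun D hD => ?_⟩
      · rcases List.mem_cons.1 hD with rfl | hD
        exacts [List.mem_append_left _ hBe, List.mem_append_right _ (h₁ D hD)]
      · rcases List.mem_append.1 hD with hD | hD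
        exacts [hse D hD, h₄ D hD]
    have weaken : ∀ B : PForm V, B.size ≤ b → Der Γ 1 b' B → Der Γ 5 b' (A.imp B) := by
      intro B hB h
      refine ((Der.ax (FregeAxiom.k B A) ?_).mp h).mono subset_rfl (by omega) le_rfl
      simp only [PForm.size]; omega
    induction hd with
    | nil => intro _; exact ⟨[], .nil, by simp, by simp, by simp⟩
    | @ax d B _ hB ih =>
      intro hs
      have hBs := hs B (by simp)
      obtain ⟨d', h₁, h₂, h₃, h₄⟩ := ih fun D hD => hs D (List.mem_cons_of_mem _ hD)
      exact cons h₂ h₃ h₁ h₄ (weaken B hBs (Der.ax hB (by omega)))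
    | @hyp d B _ hB ih =>
      intro hs
      have hBs := hs B (by simp)
      obtain ⟨d', h₁, h₂, h₃, h₄⟩ := ih fun D hD => hs D (List.mem_cons_of_mem _ hD)
      refine cons h₂ h₃ h₁ h₄ ?_
      rcases Set.mem_insert_iff.1 hB with rfl | hB
      · exact Der.imp_self (by omega)
      · exact weaken B hBs (Der.hyp hB (by omega))
    | @mp d C B _ hCB hC ih =>
      intro hs
      have hBs := hs B (by simp)
      have hCs := hs C (List.mem_cons_of_mem _ hC)
      have hCBs := hs _ (List.mem_cons_of_mem _ hCB)
      obtain ⟨d', h₁, h₂, h₃, h₄⟩ := ih fun D hD => hs D (List.mem_cons_of_mem _ hD)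
      have hax : FregeDerivation Γ ((A.imp B) :: ((A.imp C).imp (A.imp B)) ::
          ((A.imp (C.imp B)).imp ((A.imp C).imp (A.imp B))) :: d') := by
        refine ((h₁.ax (FregeAxiom.s A C B)).mp (A := A.imp (C.imp B)) (by simp) ?_).mp
          (A := A.imp C) (by simp) ?_
        · exact List.mem_cons_of_mem _ (h₂ _ hCB)
        · exact List.mem_cons_of_mem _ (List.mem_cons_of_mem _ (h₂ _ hC))
      refine ⟨_, hax, fun D hD => ?_, by simp; omega, fun D hD => ?_⟩
      · rcases List.mem_cons.1 hD with rfl | hD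
        · simp
        · exact List.mem_cons_of_mem _ (List.mem_cons_of_mem _ (List.mem_cons_of_mem _ (h₂ D hD)))
      · simp only [PForm.size] at hCBs
        simp only [List.mem_cons] at hD
        rcases hD with rfl | rfl | rfl | hD
        · simp only [PForm.size]; omega
        · simp only [PForm.size]; omega
        · simp only [PForm.size]; omega
        · exact h₄ D hD
  obtain ⟨d', h₁, h₂, h₃, h₄⟩ := key d hd hs
  exact ⟨d', h₁, h₂ B hB, by omega, h₄⟩

theorem disj_intro {l : List (PForm V)} (h : Der Γ L b A) (hA : A ∈ l)
    (hb : 2 * (PForm.disj l).size ≤ b) : Der Γ (L + 2 * l.length) b (PForm.disj l) := by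
  induction l with
  | nil => simp at hA
  | cons D l ih =>
    simp only [PForm.disj, PForm.size] at hb
    rcases List.mem_cons.1 hA with rfl | hA
    · refine ((Der.ax (FregeAxiom.or_inl A (PForm.disj l)) ?_).mp h).mono subset_rfl ?_ le_rfl
      · simp only [PForm.size]; omega
      · simp; omega
    · refine ((Der.ax (FregeAxiom.or_inr D (PForm.disj l)) ?_).mp
        (ih hA (by omega))).mono subset_rfl ?_ le_rfl
      · simp only [PForm.size]; omega
      · simp; omega

theorem disj_imp {l : List (PForm V)} (h : ∀ A ∈ l, Der Γ L b (A.imp C))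
    (hb : 2 * (PForm.disj l).size + 3 * C.size + 5 ≤ b) :
    Der Γ (l.length * (L + 3) + 1) b ((PForm.disj l).imp C) := by
  induction l with
  | nil =>
    simp only [PForm.disj, PForm.size] at hb
    refine (Der.ax (FregeAxiom.falsum_elim C) ?_).mono subset_rfl (by simp) le_rfl
    simp only [PForm.size]; omega
  | cons D l ih =>
    simp only [PForm.disj, PForm.size] at hb
    refine (((Der.ax (FregeAxiom.or_elim D (PForm.disj l) C) ?_).mp (h D (by simp))).mp
      (ih (fun A hA => h A (List.mem_cons_of_mem _ hA)) (by omega))).mono subset_rfl ?_ le_rfl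
    · simp only [PForm.size]; omega
    · simp only [List.length_cons, Nat.add_mul]; omega

end Der

/-! ### Derivations of polynomial size -/

/-- `A` has a derivation from `Γ` whose lines are bounded in number and size by `T ^ (c + 1)`. -/
def Pr (T : ℕ) (Γ : Set (PForm V)) (c : ℕ) (A : PForm V) : Prop :=
  Der Γ (T ^ (c + 1)) (T ^ (c + 1)) A

namespace Pr

variable {T c c' : ℕ}

theorem mono (h : Pr T Γ c A) (hT : 100 ≤ T) (hΓ : Γ ⊆ Δ) (hc : c ≤ c') : Pr T Δ c' A :=
  Der.mono h hΓ (Nat.pow_le_pow_right (by omega) (by omega))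
    (Nat.pow_le_pow_right (by omega) (by omega))

theorem le_pow (T c : ℕ) : T ≤ T ^ (c + 1) :=
  Nat.le_self_pow (by omega) T

/-- The factor 100 pays for the constants of each rule below. A rule thus raises the exponent by a
fixed amount, and the exponent measures the nesting depth of an argument, not its number of cases.
-/
theorem pow_step (hT : 100 ≤ T) (c : ℕ) : 100 * T ^ (c + 1) ≤ T ^ (c + 1 + 1) := by
  rw [pow_succ T (c + 1), mul_comm]
  exact Nat.mul_le_mul_left _ hT

theorem hyp (hT : 100 ≤ T) (h : A ∈ Γ) (hA : A.size ≤ T) : Pr T Γ 0 A :=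
  (Der.hyp h hA).mono subset_rfl (by simp; omega) (by simp)

theorem ax (hT : 100 ≤ T) (h : FregeAxiom A) (hA : A.size ≤ 100 * T) : Pr T Γ 1 A := by
  have h₁ := pow_step hT 0
  have h₂ := le_pow T 1
  simp only [zero_add, pow_one] at h₁
  exact (Der.ax h (hA.trans h₁)).mono subset_rfl (by omega) le_rfl

theorem mp (hT : 100 ≤ T) (h₁ : Pr T Γ c (A.imp B)) (h₂ : Pr T Γ c A) : Pr T Γ (c + 1) B := by
  have h₃ := pow_step hT c
  have h₄ := le_pow T c
  exact (Der.mp h₁ h₂).mono subset_rfl (by omega) (by omega)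

theorem deduction (hT : 100 ≤ T) (h : Pr T (insert A Γ) c B) (hA : A.size ≤ T) :
    Pr T Γ (c + 1) (A.imp B) := by
  have h₃ := pow_step hT c
  have h₄ := le_pow T c
  exact (Der.deduction (b' := T ^ (c + 1 + 1)) h (by omega)).mono subset_rfl (by omega) le_rfl

theorem exfalso (hT : 100 ≤ T) (h : Pr T Γ c .falsum) (hA : A.size ≤ T) : Pr T Γ (c + 2) A :=
  mp hT ((ax hT (.falsum_elim A) (by simp only [PForm.size]; omega)).mono hT subset_rfl
    (c' := c + 1) (by omega)) (h.mono hT subset_rfl (by omega))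

theorem neg_intro (hT : 100 ≤ T) (h : Pr T (insert A Γ) c .falsum) (hA : A.size ≤ T) :
    Pr T Γ (c + 5) A.neg := by
  have h₁ : Pr T Γ (c + 3) (A.imp .falsum) :=
    (deduction hT h hA).mono hT subset_rfl (by omega)
  have h₂ : Pr T Γ (c + 4) (A.imp (PForm.falsum.neg)) :=
    (deduction hT (exfalso hT h (by simp only [PForm.size]; omega)) hA).mono hT subset_rfl
      (by omega)
  refine mp hT (mp hT ?_ h₁) h₂
  exact (ax hT (.neg_intro A .falsum) (by simp only [PForm.size]; omega)).mono hT subset_rfl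
    (by omega)

/-- Both A and its negation follow from ¬⊥, so negation introduction gives ¬¬⊥. -/
theorem absurd (hT : 100 ≤ T) (h : Pr T Γ c A) (h' : Pr T Γ c A.neg) (hA : A.size ≤ T) :
    Pr T Γ (c + 6) .falsum := by
  have hK : ∀ {B : PForm V}, B.size ≤ T + 1 → Pr T Γ c B →
      Pr T Γ (c + 2) ((PForm.falsum.neg).imp B) := fun hB hp =>
    mp hT (c := c + 1) ((ax hT (.k _ _) (by simp only [PForm.size]; omega)).mono hT subset_rfl
      (by omega)) (hp.mono hT subset_rfl (by omega))
  have h₁ : Pr T Γ (c + 3) ((PForm.falsum.neg).imp A) :=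
    (hK (by omega) h).mono hT subset_rfl (by omega)
  have h₂ : Pr T Γ (c + 4) ((PForm.falsum.neg).imp A.neg) :=
    (hK (by simp only [PForm.size]; omega) h').mono hT subset_rfl (by omega)
  have h₃ : Pr T Γ (c + 5) (PForm.falsum.neg.neg) := by
    refine mp hT (mp hT ?_ h₁) h₂
    exact (ax hT (.neg_intro _ A) (by simp only [PForm.size]; omega)).mono hT subset_rfl (by omega)
  exact mp hT ((ax hT (.neg_neg _) (by simp only [PForm.size]; omega)).mono hT subset_rfl
    (by omega)) h₃

theorem by_contra (hT : 100 ≤ T) (h : Pr T (insert A.neg Γ) c .falsum) (hA : A.size < T) :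
    Pr T Γ (c + 6) A :=
  mp hT ((ax hT (.neg_neg A) (by simp only [PForm.size]; omega)).mono hT subset_rfl (by omega))
    (neg_intro hT h (by simp only [PForm.size]; omega))

/-- Under the assumption ¬C the first case refutes A, so the second case gives C. The strict size
bounds leave room for a negation sign. -/
theorem by_cases (hT : 100 ≤ T) (A : PForm V) (h : Pr T (insert A Γ) c C)
    (h' : Pr T (insert A.neg Γ) c C) (hA : A.size < T) (hC : C.size < T) :
    Pr T Γ (c + 24) C := by
  have hC' : C.neg.size ≤ T := by simp only [PForm.size]; omega
  have h₁ : Pr T (insert A (insert C.neg Γ)) (c + 6) .falsum :=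
    absurd hT (h.mono hT (Set.insert_subset_insert (Set.subset_insert _ _)) (by omega))
      ((hyp hT (by simp) hC').mono hT subset_rfl (by omega)) hC.le
  have h₂ : Pr T (insert C.neg Γ) (c + 11) A.neg := neg_intro hT h₁ hA.le
  have h₃ : Pr T (insert C.neg Γ) (c + 12) C := by
    refine mp hT ((deduction hT h' (by simp only [PForm.size]; omega)).mono hT
      (Set.subset_insert _ _) (by omega)) h₂
  have h₄ : Pr T (insert C.neg Γ) (c + 12) C.neg :=
    (hyp hT (by simp) hC').mono hT subset_rfl (by omega)
  exact by_contra hT (absurd hT h₃ h₄ hC.le) hC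

theorem cut (hT : 100 ≤ T) (h : Pr T Γ c A) (h' : Pr T (insert A Γ) c C) (hA : A.size ≤ T) :
    Pr T Γ (c + 2) C :=
  mp hT (deduction hT h' hA) (h.mono hT subset_rfl (by omega))

theorem disj_intro (hT : 100 ≤ T) {l : List (PForm V)} (h : Pr T Γ c A) (hA : A ∈ l)
    (hl : (PForm.disj l).size ≤ T) : Pr T Γ (c + 1) (PForm.disj l) := by
  have h₃ := pow_step hT c
  have h₄ := le_pow T c
  have hlen : ∀ l : List (PForm V), l.length ≤ (PForm.disj l).size := by
    intro l
    induction l with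
    | nil => simp
    | cons D l ih => simp only [PForm.disj, PForm.size, List.length_cons]; omega
  have h₅ := hlen l
  exact (Der.disj_intro (b := T ^ (c + 1 + 1)) (Der.mono h subset_rfl le_rfl (by omega)) hA
    (by omega)).mono subset_rfl (by omega) le_rfl

theorem disj_elim (hT : 100 ≤ T) {l : List (PForm V)} (h : Pr T Γ c (PForm.disj l))
    (h' : ∀ A ∈ l, Pr T (insert A Γ) c C) (hl : (PForm.disj l).size ≤ T) (hC : C.size ≤ T) :
    Pr T Γ (c + 4) C := by
  have hlen : ∀ l : List (PForm V), l.length ≤ (PForm.disj l).size ∧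
      ∀ A ∈ l, A.size ≤ (PForm.disj l).size := by
    intro l
    induction l with
    | nil => simp
    | cons D l ih =>
      simp only [PForm.disj, PForm.size, List.length_cons, List.mem_cons]
      refine ⟨by omega, ?_⟩
      rintro A (rfl | hA)
      · omega
      · have := ih.2 A hA
        omega
  obtain ⟨h₅, h₆⟩ := hlen l
  have h₁ : ∀ A ∈ l, Pr T Γ (c + 1) (A.imp C) := fun A hA =>
    deduction hT (h' A hA) ((h₆ A hA).trans hl)
  have p₁ := pow_step hT c
  have p₂ : 100 * T ^ (c + 1 + 1) ≤ T ^ (c + 2 + 1) := pow_step hT (c + 1)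
  have p₃ : 100 * T ^ (c + 2 + 1) ≤ T ^ (c + 3 + 1) := pow_step hT (c + 2)
  have p₄ := le_pow T c
  have h₂ : Pr T Γ (c + 3) ((PForm.disj l).imp C) := by
    refine (Der.disj_imp (L := T ^ (c + 1 + 1)) (b := T ^ (c + 2 + 1))
      (fun A hA => Der.mono (h₁ A hA) subset_rfl le_rfl
        (Nat.pow_le_pow_right (by omega) (by omega))) ?_).mono subset_rfl ?_ ?_
    · omega
    · have : l.length * (T ^ (c + 1 + 1) + 3) ≤ T * (2 * T ^ (c + 1 + 1)) :=
        Nat.mul_le_mul (by omega) (by omega)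
      have e : T * (2 * T ^ (c + 1 + 1)) = 2 * T ^ (c + 2 + 1) := by ring
      omega
    · exact Nat.pow_le_pow_right (by omega) (by omega)
  exact mp hT h₂ (h.mono hT subset_rfl (by omega))

end Pr

end Frege

/-! ### Rankings -/

theorem Prefers.asymm {m : ℕ} {π : Ranking m} {a b : Fin m} (h : Prefers π a b) :
    ¬ Prefers π b a :=
  lt_asymm h

theorem prefers_of_not {m : ℕ} {π : Ranking m} {a b : Fin m} (hab : a ≠ b)
    (h : ¬ Prefers π a b) : Prefers π b a :=
  lt_of_le_of_ne (not_lt.1 h) fun e => hab (π.symm.injective e).symm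

theorem prefers_revPerm {m : ℕ} {a b : Fin m} :
    Prefers (Fin.revPerm : Ranking m) a b ↔ b < a := by
  simp [Prefers]

theorem exists_ranking_three {m : ℕ} {x y z : Fin m} (hxy : x ≠ y) (hxz : x ≠ z) (hyz : y ≠ z) :
    ∃ π : Ranking m, Prefers π x y ∧ Prefers π y z := by
  have hm : 3 ≤ m := by
    have : ({x, y, z} : Finset (Fin m)).card = 3 := by
      rw [Finset.card_eq_three]; exact ⟨x, y, z, hxy, hxz, hyz, rfl⟩
    have h' := Finset.card_le_univ ({x, y, z} : Finset (Fin m))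
    rw [this, Fintype.card_fin] at h'
    exact h'
  let i₀ : Fin m := ⟨0, by omega⟩
  let i₁ : Fin m := ⟨1, by omega⟩
  let i₂ : Fin m := ⟨2, by omega⟩
  have h₀₁ : i₀ ≠ i₁ := by simp [i₀, i₁]
  have h₀₂ : i₀ ≠ i₂ := by simp [i₀, i₂]
  have h₁₂ : i₁ ≠ i₂ := by simp [i₁, i₂]
  -- Three transpositions put x, y, z into the positions 0, 1, 2 in turn; each later one fixes the
  -- objects already placed.
  let s₁ : Ranking m := Equiv.swap i₀ x
  let s₂ : Ranking m := Equiv.swap (s₁ i₁) y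
  let s₃ : Ranking m := Equiv.swap (s₂ (s₁ i₂)) z
  have a₀ : s₁ i₀ = x := Equiv.swap_apply_left _ _
  have a₁ : s₂ x = x := by
    refine Equiv.swap_apply_of_ne_of_ne ?_ hxy
    rw [← a₀]; exact fun h => h₀₁ (s₁.injective h)
  have a₂ : s₂ (s₁ i₁) = y := Equiv.swap_apply_left _ _
  have a₃ : s₃ (s₂ (s₁ i₂)) = z := Equiv.swap_apply_left _ _
  have a₄ : s₃ x = x := by
    refine Equiv.swap_apply_of_ne_of_ne ?_ hxz
    nth_rewrite 1 [← a₁, ← a₀]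
    exact fun h => h₀₂ (s₁.injective (s₂.injective h))
  have a₅ : s₃ y = y := by
    refine Equiv.swap_apply_of_ne_of_ne ?_ hyz
    nth_rewrite 1 [← a₂]
    exact fun h => h₁₂ (s₁.injective (s₂.injective h))
  let π : Ranking m := s₃ * s₂ * s₁
  have b₀ : π.symm x = i₀ := by
    rw [Equiv.symm_apply_eq]; simp [π, a₀, a₁, a₄]
  have b₁ : π.symm y = i₁ := by
    rw [Equiv.symm_apply_eq]; simp [π, a₂, a₅]
  have b₂ : π.symm z = i₂ := by
    rw [Equiv.symm_apply_eq]; simp [π, a₃]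
  exact ⟨π, by simp only [Prefers, b₀, b₁]; simp [i₀, i₁, Fin.lt_def],
    by simp only [Prefers, b₁, b₂]; simp [i₁, i₂, Fin.lt_def]⟩

/-- The two implications exclude exactly the two cyclic patterns; the other six are the six orders
of three objects. -/
theorem exists_ranking_of_iff {m : ℕ} {a b c : Fin m} (hab : a ≠ b) (hac : a ≠ c) (hbc : b ≠ c)
    {p q r : Prop} (h₁ : p → q → r) (h₂ : r → p ∨ q) :
    ∃ π : Ranking m, (p ↔ Prefers π a b) ∧ (q ↔ Prefers π b c) ∧ (r ↔ Prefers π a c) := by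
  have key : ∀ {x y z : Fin m}, x ≠ y → x ≠ z → y ≠ z →
      ∃ π : Ranking m, Prefers π x y ∧ Prefers π y z ∧ Prefers π x z ∧
        ¬ Prefers π y x ∧ ¬ Prefers π z y ∧ ¬ Prefers π z x := by
    intro x y z hxy hxz hyz
    obtain ⟨π, h, h'⟩ := exists_ranking_three hxy hxz hyz
    exact ⟨π, h, h', h.trans h', h.asymm, h'.asymm, Prefers.asymm (h.trans h')⟩
  by_cases hp : p <;> by_cases hq : q <;> by_cases hr : r
  · obtain ⟨π, h⟩ := key hab hac hbc; exact ⟨π, by tauto⟩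
  · tauto
  · obtain ⟨π, h⟩ := key hac hab hbc.symm; exact ⟨π, by tauto⟩
  · obtain ⟨π, h⟩ := key hac.symm hbc.symm hab; exact ⟨π, by tauto⟩
  · obtain ⟨π, h⟩ := key hab.symm hbc hac; exact ⟨π, by tauto⟩
  · obtain ⟨π, h⟩ := key hbc hab.symm hac.symm; exact ⟨π, by tauto⟩
  · tauto
  · obtain ⟨π, h⟩ := key hbc.symm hac.symm hab.symm; exact ⟨π, by tauto⟩

/-- If the rankings agreed on all pairs, then π⁻¹ρ would be an order automorphism of `Fin m`, and
the identity is the only one. -/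
theorem exists_prefers_of_ne {m : ℕ} {π ρ : Ranking m} (h : π ≠ ρ) :
    ∃ x y, x ≠ y ∧ Prefers ρ x y ∧ Prefers π y x := by
  by_contra! hno
  have mono : StrictMono fun i => π.symm (ρ i) := by
    intro i j hij
    have hne : ρ i ≠ ρ j := fun e => hij.ne (ρ.injective e)
    have := hno (ρ i) (ρ j) hne (by simpa [Prefers] using hij)
    exact lt_of_le_of_ne this fun e => hne (π.symm.injective e)
  have hsurj : Function.Surjective fun i => π.symm (ρ i) :=
    π.symm.surjective.comp ρ.surjective
  have : StrictMono.orderIsoOfSurjective _ mono hsurj = OrderIso.refl _ := Subsingleton.elim _ _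
  apply h
  ext i
  have hi := congrArg (fun e : Fin m ≃o Fin m => e i) this
  simp only [StrictMono.coe_orderIsoOfSurjective, OrderIso.refl_apply] at hi
  rw [← (Equiv.symm_apply_eq π).1 hi]

/-- The profile in which exactly the agents in `S` prefer `a` to `b`. -/
def coalitionProfile {m n : ℕ} (S : Finset (Fin n)) (a b : Fin m) : Profile m n := fun i =>
  -- The identity prefers the smaller index and its reversal the larger one, so two rankings
  -- suffice.
  if (i ∈ S ↔ a < b) then 1 else Fin.revPerm

theorem coalitionProfile_prefers {m n : ℕ} (S : Finset (Fin n)) {a b : Fin m} (hab : a ≠ b)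
    (i : Fin n) : Prefers (coalitionProfile S a b i) a b ↔ i ∈ S := by
  unfold coalitionProfile
  split_ifs with h
  · rw [h]; rfl
  · rw [prefers_revPerm]
    have : b < a ↔ ¬ a < b := ⟨fun h => h.asymm, fun h => lt_of_le_of_ne (not_lt.1 h) hab.symm⟩
    rw [this]
    tauto

/-! ### Derivations from the clauses of the Arrow formula -/

section Arrow

variable {m n T k : ℕ} {Γ Δ : Set (PForm (ArrowVar m n))} {C : PForm (ArrowVar m n)}

/-- The hypotheses `Γ` contain the clauses of the Arrow formula, and `T` bounds their size. -/
structure ArrowContext (m n T : ℕ) (Γ : Set (PForm (ArrowVar m n))) : Prop where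
  bound : 1000 * m.factorial ^ (n + 1) ≤ T
  clauses : CNF.forms (arrowFormula m n) ⊆ Γ

theorem ArrowContext.mono (h : ArrowContext m n T Γ) (hΓ : Γ ⊆ Δ) : ArrowContext m n T Δ :=
  ⟨h.bound, h.clauses.trans hΓ⟩

theorem ArrowContext.insert (h : ArrowContext m n T Γ) (A : PForm (ArrowVar m n)) :
    ArrowContext m n T (insert A Γ) :=
  h.mono (Set.subset_insert _ _)

theorem ArrowContext.hT (h : ArrowContext m n T Γ) : 100 ≤ T := by
  have := h.bound
  have := pow_pos m.factorial_pos (n + 1)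
  omega

/-- All sizes are measured by this number: clauses and disjunctions of variables are linear in it.
-/
theorem card_arrowVar (m n : ℕ) : Fintype.card (ArrowVar m n) = m.factorial ^ (n + 1) := by
  simp [Fintype.card_perm, pow_succ]

theorem size_disj_map_le {V X : Type} (f : X → PForm V) (s : ℕ) (l : List X)
    (h : ∀ x ∈ l, (f x).size ≤ s) : (PForm.disj (l.map f)).size ≤ (s + 1) * l.length + 1 := by
  induction l with
  | nil => simp [PForm.disj, PForm.size]
  | cons x l ih =>
    have h₁ := h x (by simp)
    have h₂ := ih fun y hy => h y (List.mem_cons_of_mem _ hy)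
    simp only [List.map_cons, PForm.disj, PForm.size, List.length_cons, Nat.mul_add]
    omega

theorem Literal.size_toForm_le {V : Type} (l : Literal V) : (Literal.toForm l).size ≤ 2 := by
  unfold Literal.toForm
  split_ifs <;> simp [PForm.size]

theorem size_clause_le {V : Type} (c : Clause V) : (Clause.toForm c).size ≤ 3 * c.card + 1 := by
  have := size_disj_map_le Literal.toForm 2 c.toList fun l _ => l.size_toForm_le
  rwa [Finset.length_toList] at this

theorem size_arrowClause_le (c : Clause (ArrowVar m n)) :
    (Clause.toForm c).size ≤ 7 * m.factorial ^ (n + 1) := by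
  have h₁ := size_clause_le c
  have h₂ := Finset.card_le_univ c
  rw [Fintype.card_prod, card_arrowVar, Fintype.card_bool] at h₂
  have := pow_pos m.factorial_pos (n + 1)
  omega

theorem ArrowContext.clause_elim (h : ArrowContext m n T Γ) {c : Clause (ArrowVar m n)}
    (hc : IsArrowClause m n c) (h' : ∀ l ∈ c, Pr T (Insert.insert (Literal.toForm l) Γ) k C)
    (hC : C.size ≤ T) : Pr T Γ (k + 4) C := by
  have hs : (Clause.toForm c).size ≤ T := by
    have := size_arrowClause_le c
    have := h.bound
    omega
  have hmem : c ∈ arrowFormula m n := by simpa [arrowFormula] using hc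
  refine Pr.disj_elim h.hT ((Pr.hyp h.hT (h.clauses ⟨c, hmem, rfl⟩) hs).mono h.hT subset_rfl
    (Nat.zero_le k)) (fun A hA => ?_) hs hC
  obtain ⟨l, hl, rfl⟩ := List.mem_map.1 hA
  exact h' l (Finset.mem_toList.1 hl)

/-- The disjunction of a set of variables. -/
noncomputable def varDisj {V : Type} (s : Finset V) : PForm V :=
  PForm.disj (s.toList.map PForm.var)

theorem ArrowContext.size_varDisj (h : ArrowContext m n T Γ) (s : Finset (ArrowVar m n)) :
    2 * (varDisj s).size ≤ T := by
  have h₁ := size_disj_map_le (PForm.var (V := ArrowVar m n)) 1 s.toList fun l _ => le_rfl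
  have h₂ := Finset.card_le_univ s
  rw [card_arrowVar] at h₂
  rw [Finset.length_toList] at h₁
  have h₃ := h.bound
  have := pow_pos m.factorial_pos (n + 1)
  unfold varDisj
  omega

theorem ArrowContext.varDisj_intro (h : ArrowContext m n T Γ) {s : Finset (ArrowVar m n)}
    {v : ArrowVar m n} (hv : v ∈ s) (h' : Pr T Γ k (.var v)) : Pr T Γ (k + 1) (varDisj s) :=
  Pr.disj_intro h.hT h' (List.mem_map.2 ⟨v, Finset.mem_toList.2 hv, rfl⟩)
    (by have := h.size_varDisj s; unfold varDisj at this; omega)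

theorem ArrowContext.varDisj_elim (h : ArrowContext m n T Γ) {s : Finset (ArrowVar m n)}
    (h₁ : Pr T Γ k (varDisj s)) (h₂ : ∀ v ∈ s, Pr T (Insert.insert (.var v) Γ) k C)
    (hC : C.size ≤ T) : Pr T Γ (k + 4) C := by
  refine Pr.disj_elim h.hT h₁ (fun A hA => ?_)
    (by have := h.size_varDisj s; unfold varDisj at this; omega) hC
  obtain ⟨l, hl, rfl⟩ := List.mem_map.1 hA
  exact h₂ l (Finset.mem_toList.1 hl)

theorem ArrowContext.var_hyp (h : ArrowContext m n T Γ) {v : ArrowVar m n} (hv : .var v ∈ Γ) :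
    Pr T Γ k (.var v) :=
  (Pr.hyp h.hT hv (by have := h.hT; simp only [PForm.size]; omega)).mono h.hT subset_rfl
    (Nat.zero_le k)

theorem ArrowContext.clash (h : ArrowContext m n T Γ) {x y : ArrowVar m n}
    (hc : IsArrowClause m n {(x, false), (y, false)}) (hx : Pr T Γ k (.var x))
    (hy : Pr T Γ k (.var y)) (hC : C.size ≤ T) : Pr T Γ (k + 12) C := by
  have hT := h.hT
  refine h.clause_elim (k := k + 8) hc (fun l hl => ?_) hC
  refine Pr.exfalso hT ?_ hC
  have key : ∀ z, Pr T Γ k (.var z) →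
      Pr T (Insert.insert (Literal.toForm (z, false)) Γ) (k + 6) .falsum := fun z hz =>
    Pr.absurd hT (hz.mono hT (Set.subset_insert _ _) le_rfl)
      ((Pr.hyp hT (by simp [Literal.toForm]) (by simp only [PForm.size]; omega)).mono hT subset_rfl
        (Nat.zero_le k)) (by simp only [PForm.size]; omega)
  simp only [Finset.mem_insert, Finset.mem_singleton] at hl
  rcases hl with rfl | rfl
  exacts [key x hx, key y hy]

open Classical in
/-- The profile `R` is aggregated to a ranking that prefers `a` to `b`. -/
noncomputable def aggPrefers (R : Profile m n) (a b : Fin m) : PForm (ArrowVar m n) :=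
  varDisj (Finset.univ.filter fun v => v.1 = R ∧ Prefers v.2 a b)

variable {R R' : Profile m n} {a b c : Fin m}

theorem ArrowContext.size_aggPrefers (h : ArrowContext m n T Γ) :
    (aggPrefers R a b).size < T := by
  have h₁ := h.hT
  have h₂ : 2 * (aggPrefers R a b).size ≤ T := h.size_varDisj _
  omega

theorem ArrowContext.aggPrefers_intro (h : ArrowContext m n T Γ) {π : Ranking m}
    (hπ : Prefers π a b) (h' : Pr T Γ k (.var (R, π))) : Pr T Γ (k + 1) (aggPrefers R a b) :=
  h.varDisj_intro (v := (R, π)) (by simpa using hπ) h'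

theorem ArrowContext.aggPrefers_elim (h : ArrowContext m n T Γ)
    (h₁ : Pr T Γ k (aggPrefers R a b))
    (h₂ : ∀ π, Prefers π a b → Pr T (Insert.insert (.var (R, π)) Γ) k C) (hC : C.size ≤ T) :
    Pr T Γ (k + 4) C := by
  refine h.varDisj_elim h₁ (fun v hv => ?_) hC
  obtain ⟨R', π⟩ := v
  simp only [Finset.mem_filter, Finset.mem_univ, true_and] at hv
  obtain ⟨rfl, hπ⟩ := hv
  exact h₂ π hπ

theorem ArrowContext.total_elim (h : ArrowContext m n T Γ) (R : Profile m n)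
    (h' : ∀ π, Pr T (Insert.insert (.var (R, π)) Γ) k C) (hC : C.size ≤ T) :
    Pr T Γ (k + 4) C := by
  refine h.clause_elim (.total R) (fun l hl => ?_) hC
  simp only [Finset.mem_image, Finset.mem_univ, true_and] at hl
  obtain ⟨π, rfl⟩ := hl
  exact h' π

/-- Case analysis on the outcome: two outcomes of R coincide by uniqueness, and for a single ranking
transitivity is a fact outside the calculus. -/
theorem ArrowContext.aggPrefers_trans (h : ArrowContext m n T Γ)
    (h₁ : Pr T Γ k (aggPrefers R a b)) (h₂ : Pr T Γ k (aggPrefers R b c)) :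
    Pr T Γ (k + 20) (aggPrefers R a c) := by
  have hT := h.hT
  refine h.aggPrefers_elim (k := k + 16) (h₁.mono hT subset_rfl (by omega)) (fun π hπ => ?_)
    h.size_aggPrefers.le
  have g := h.insert (.var (R, π))
  refine g.aggPrefers_elim (k := k + 12) (h₂.mono hT (Set.subset_insert _ _) (by omega))
    (fun ρ hρ => ?_) h.size_aggPrefers.le
  have g' := g.insert (.var (R, ρ))
  by_cases e : π = ρ
  · subst e
    exact (g'.aggPrefers_intro (k := 0) (hπ.trans hρ) (g'.var_hyp (by simp))).mono hT subset_rfl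
      (by omega)
  · exact g'.clash (.unique R π ρ e) (g'.var_hyp (by simp)) (g'.var_hyp (by simp))
      h.size_aggPrefers.le

theorem ArrowContext.aggPrefers_contra (h : ArrowContext m n T Γ)
    (h₁ : Pr T Γ k (aggPrefers R a b)) (h₂ : Pr T Γ k (aggPrefers R b a)) (hC : C.size ≤ T) :
    Pr T Γ (k + 20) C := by
  have hT := h.hT
  refine h.aggPrefers_elim (k := k + 16) (h₁.mono hT subset_rfl (by omega)) (fun π hπ => ?_) hC
  have g := h.insert (.var (R, π))
  refine g.aggPrefers_elim (k := k + 12) (h₂.mono hT (Set.subset_insert _ _) (by omega))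
    (fun ρ hρ => ?_) hC
  have g' := g.insert (.var (R, ρ))
  refine g'.clash (.unique R π ρ ?_) (g'.var_hyp (by simp)) (g'.var_hyp (by simp)) hC
  rintro rfl
  exact hπ.asymm hρ

/-- R' has some outcome, and if it prefers b to a, it clashes with the outcome of R. -/
theorem ArrowContext.aggPrefers_iia (h : ArrowContext m n T Γ) (hab : a ≠ b)
    (hR : ∀ i, Prefers (R i) a b ↔ Prefers (R' i) a b) (h₁ : Pr T Γ k (aggPrefers R a b)) :
    Pr T Γ (k + 20) (aggPrefers R' a b) := by
  have hT := h.hT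
  refine h.total_elim (k := k + 16) R' (fun π => ?_) h.size_aggPrefers.le
  have g := h.insert (.var (R', π))
  by_cases hπ : Prefers π a b
  · exact (g.aggPrefers_intro (k := 0) hπ (g.var_hyp (by simp))).mono hT subset_rfl (by omega)
  refine g.aggPrefers_elim (k := k + 12) (h₁.mono hT (Set.subset_insert _ _) (by omega))
    (fun ρ hρ => ?_) h.size_aggPrefers.le
  have g' := g.insert (.var (R, ρ))
  exact g'.clash (.iia a b R R' ρ π hR (.inl ⟨hρ, prefers_of_not hab hπ⟩)) (g'.var_hyp (by simp))
    (g'.var_hyp (by simp)) h.size_aggPrefers.le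

theorem ArrowContext.aggPrefers_unanimous (h : ArrowContext m n T Γ) (hab : a ≠ b)
    (hR : ∀ i, Prefers (R i) a b) : Pr T Γ 10 (aggPrefers R a b) := by
  have hT := h.hT
  refine h.clause_elim (k := 6) (.unanimous a b R hab hR) (fun l hl => ?_) h.size_aggPrefers.le
  simp only [Finset.mem_image, Finset.mem_filter, Finset.mem_univ, true_and] at hl
  obtain ⟨π, hπ, rfl⟩ := hl
  exact ((h.insert _).aggPrefers_intro (k := 0) hπ
    ((h.insert _).var_hyp (by simp [Literal.toForm]))).mono hT subset_rfl (by omega)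

theorem ArrowContext.aggPrefers_cases (h : ArrowContext m n T Γ) (R : Profile m n) (hab : a ≠ b)
    (h₁ : Pr T (Insert.insert (aggPrefers R a b) Γ) k C)
    (h₂ : Pr T (Insert.insert (aggPrefers R b a) Γ) k C) (hC : C.size ≤ T) :
    Pr T Γ (k + 10) C := by
  have hT := h.hT
  refine h.total_elim (k := k + 6) R (fun π => ?_) hC
  have g := h.insert (.var (R, π))
  by_cases hπ : Prefers π a b
  · exact Pr.cut hT (c := k + 4) ((g.aggPrefers_intro (k := k) hπ (g.var_hyp (by simp))).mono hT
      subset_rfl (by omega)) (h₁.mono hT (Set.insert_subset_insert (Set.subset_insert _ _))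
      (by omega)) h.size_aggPrefers.le
  · exact Pr.cut hT (c := k + 4) ((g.aggPrefers_intro (k := k) (prefers_of_not hab hπ)
      (g.var_hyp (by simp))).mono hT subset_rfl (by omega))
      (h₂.mono hT (Set.insert_subset_insert (Set.subset_insert _ _)) (by omega))
      h.size_aggPrefers.le

/-! ### Decisive coalitions -/

/-- The coalition `S` is decisive for `a` against `b`. -/
noncomputable def decisive (S : Finset (Fin n)) (a b : Fin m) : PForm (ArrowVar m n) :=
  -- One profile represents all those in which S prefers a to b and everyone else b to a, by
  -- independence.
  aggPrefers (coalitionProfile S a b) a b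

variable {S S' S'' : Finset (Fin n)} {x y : Fin m}

theorem ArrowContext.decisive_of_aggPrefers (h : ArrowContext m n T Γ) (hab : a ≠ b)
    (hR : ∀ i, i ∈ S ↔ Prefers (R i) a b) (h₁ : Pr T Γ k (aggPrefers R a b)) :
    Pr T Γ (k + 20) (decisive S a b) :=
  h.aggPrefers_iia hab (fun i => by rw [coalitionProfile_prefers S hab, hR]) h₁

theorem ArrowContext.aggPrefers_of_decisive (h : ArrowContext m n T Γ) (hab : a ≠ b)
    (hR : ∀ i, i ∈ S ↔ Prefers (R i) a b) (h₁ : Pr T Γ k (decisive S a b)) :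
    Pr T Γ (k + 20) (aggPrefers R a b) :=
  h.aggPrefers_iia hab (fun i => by rw [coalitionProfile_prefers S hab, hR]) h₁

theorem ArrowContext.size_decisive (h : ArrowContext m n T Γ) : (decisive S a b).size < T :=
  h.size_aggPrefers

theorem ArrowContext.decisive_hyp (h : ArrowContext m n T Γ) (hS : decisive S a b ∈ Γ) :
    Pr T Γ k (decisive S a b) :=
  (Pr.hyp h.hT hS h.size_decisive.le).mono h.hT subset_rfl (Nat.zero_le k)

theorem ArrowContext.decisive_univ (h : ArrowContext m n T Γ) (hab : a ≠ b) :
    Pr T Γ (k + 10) (decisive Finset.univ a b) :=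
  (h.aggPrefers_unanimous hab fun i => by simp [coalitionProfile_prefers _ hab]).mono h.hT
    subset_rfl (by omega)

theorem ArrowContext.decisive_empty (h : ArrowContext m n T Γ) (hab : a ≠ b)
    (h₁ : Pr T Γ k (decisive ∅ a b)) (hC : C.size ≤ T) : Pr T Γ (k + 30) C := by
  refine h.aggPrefers_contra (k := k + 10) (h₁.mono h.hT subset_rfl (by omega))
    ((h.aggPrefers_unanimous hab.symm fun i => ?_).mono h.hT subset_rfl (by omega)) hC
  exact prefers_of_not hab (by simp [coalitionProfile_prefers _ hab])

theorem ArrowContext.decisive_cases (h : ArrowContext m n T Γ) (S : Finset (Fin n)) (hab : a ≠ b)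
    (h₁ : Pr T (Insert.insert (decisive S a b) Γ) k C)
    (h₂ : Pr T (Insert.insert (decisive Sᶜ b a) Γ) k C) (hC : C.size ≤ T) :
    Pr T Γ (k + 40) C := by
  have hT := h.hT
  refine (h.aggPrefers_cases (k := k + 22) (coalitionProfile S a b) hab
    (h₁.mono hT subset_rfl (by omega)) ?_ hC).mono hT subset_rfl (by omega)
  have g := h.insert (aggPrefers (coalitionProfile S a b) b a)
  refine Pr.cut hT (c := k + 20) (g.decisive_of_aggPrefers (S := Sᶜ) hab.symm
    (R := coalitionProfile S a b) (fun i => ?_) ((Pr.hyp hT (by simp)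
    h.size_aggPrefers.le).mono hT subset_rfl (Nat.zero_le k)))
    (h₂.mono hT (Set.insert_subset_insert (Set.subset_insert _ _)) (by omega)) h.size_decisive.le
  rw [Finset.mem_compl, ← coalitionProfile_prefers S hab]
  exact ⟨prefers_of_not hab, Prefers.asymm⟩

/-- The inclusions say that no agent needs a cyclic preference. Taking the set of all agents for S
or S' replaces one object of the pair and enlarges the coalition; S'' = S ∩ S' gives intersections.
-/
theorem ArrowContext.decisive_trans (h : ArrowContext m n T Γ) (hab : a ≠ b) (hac : a ≠ c)
    (hbc : b ≠ c) (hS : S ∩ S' ⊆ S'') (hS' : S'' ⊆ S ∪ S') (h₁ : Pr T Γ k (decisive S a b))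
    (h₂ : Pr T Γ k (decisive S' b c)) : Pr T Γ (k + 60) (decisive S'' a c) := by
  have key : ∀ i, ∃ π : Ranking m, (i ∈ S ↔ Prefers π a b) ∧ (i ∈ S' ↔ Prefers π b c) ∧
      (i ∈ S'' ↔ Prefers π a c) := fun i =>
    exists_ranking_of_iff hab hac hbc (fun h h' => hS (Finset.mem_inter.2 ⟨h, h'⟩))
      (fun h => Finset.mem_union.1 (hS' h))
  choose R hR using key
  exact h.decisive_of_aggPrefers hac (fun i => (hR i).2.2) (h.aggPrefers_trans
    (h.aggPrefers_of_decisive hab (fun i => (hR i).1) h₁)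
    (h.aggPrefers_of_decisive hbc (fun i => (hR i).2.1) h₂))

theorem exists_third {m : ℕ} (hm : 3 ≤ m) (a b : Fin m) : ∃ e, e ≠ a ∧ e ≠ b := by
  have : (({a, b} : Finset (Fin m))ᶜ).Nonempty := by
    rw [← Finset.card_pos, Finset.card_compl, Fintype.card_fin]
    have := Finset.card_le_two (a := a) (b := b)
    omega
  obtain ⟨e, he⟩ := this
  simp only [Finset.mem_compl, Finset.mem_insert, Finset.mem_singleton, not_or] at he
  exact ⟨e, he⟩

/-- All agents together are decisive for b against c, so `ArrowContext.decisive_trans` applies. When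
b = c, a third object serves as a detour. -/
theorem ArrowContext.decisive_right (h : ArrowContext m n T Γ) (hm : 3 ≤ m) (hab : a ≠ b)
    (hac : a ≠ c) (hS : S ⊆ S') (h₁ : Pr T Γ k (decisive S a b)) :
    Pr T Γ (k + 140) (decisive S' a c) := by
  have hT := h.hT
  have step : ∀ {k : ℕ} {b c : Fin m} {S S' : Finset (Fin n)}, a ≠ b → a ≠ c → b ≠ c → S ⊆ S' →
      Pr T Γ k (decisive S a b) → Pr T Γ (k + 70) (decisive S' a c) := by
    intro k b c S S' hab hac hbc hS h₁
    exact h.decisive_trans (k := k + 10) (S' := Finset.univ) hab hac hbc (by simpa using hS)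
      (fun i _ => Finset.mem_union_right _ (Finset.mem_univ i)) (h₁.mono hT subset_rfl (by omega))
      (h.decisive_univ hbc)
  by_cases hbc : b = c
  · subst hbc
    obtain ⟨e, hea, heb⟩ := exists_third hm a b
    exact step hea.symm hab heb hS (step hab hea.symm heb.symm subset_rfl h₁)
  · exact (step hab hac hbc hS h₁).mono hT subset_rfl (by omega)

theorem ArrowContext.decisive_left (h : ArrowContext m n T Γ) (hm : 3 ≤ m) (hab : a ≠ b)
    (hcb : c ≠ b) (hS : S ⊆ S') (h₁ : Pr T Γ k (decisive S a b)) :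
    Pr T Γ (k + 140) (decisive S' c b) := by
  have hT := h.hT
  have step : ∀ {k : ℕ} {a c : Fin m} {S S' : Finset (Fin n)}, a ≠ b → c ≠ b → c ≠ a → S ⊆ S' →
      Pr T Γ k (decisive S a b) → Pr T Γ (k + 70) (decisive S' c b) := by
    intro k a c S S' hab hcb hca hS h₁
    exact h.decisive_trans (k := k + 10) (S := Finset.univ) hca hcb hab (by simpa using hS)
      (fun i _ => Finset.mem_union_left _ (Finset.mem_univ i)) (h.decisive_univ hca)
      (h₁.mono hT subset_rfl (by omega))
  by_cases hca : c = a
  · subst hca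
    obtain ⟨e, hec, heb⟩ := exists_third hm c b
    exact step heb hcb hec.symm hS (step hab heb hec subset_rfl h₁)
  · exact (step hab hcb hca hS h₁).mono hT subset_rfl (by omega)

/-- One object is exchanged at a time. Reversing the pair takes three exchanges through a third
object, whence 420 = 3 · 140. -/
theorem ArrowContext.decisive_neutral (h : ArrowContext m n T Γ) (hm : 3 ≤ m) (hab : a ≠ b)
    (hxy : x ≠ y) (hS : S ⊆ S') (h₁ : Pr T Γ k (decisive S a b)) :
    Pr T Γ (k + 420) (decisive S' x y) := by
  have hT := h.hT
  by_cases hay : a = y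
  · subst hay
    by_cases hxb : x = b
    · subst hxb
      obtain ⟨e, hea, heb⟩ := exists_third hm a x
      exact h.decisive_right hm heb.symm hxy hS (h.decisive_left hm hea.symm heb.symm subset_rfl
        (h.decisive_right hm hab hea.symm subset_rfl h₁))
    · exact (h.decisive_right hm hxb hxy hS (h.decisive_left hm hab hxb subset_rfl h₁)).mono hT
        subset_rfl (by omega)
  · exact (h.decisive_left hm hay hxy hS (h.decisive_right hm hab hay subset_rfl h₁)).mono hT
      subset_rfl (by omega)

/-- With a third object e, S is decisive for x against e and S' for e against y. -/
theorem ArrowContext.decisive_inter (h : ArrowContext m n T Γ) (hm : 3 ≤ m) (hab : a ≠ b)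
    (hxy : x ≠ y) (h₁ : Pr T Γ k (decisive S a b)) (h₂ : Pr T Γ k (decisive S' a b)) :
    Pr T Γ (k + 480) (decisive (S ∩ S') x y) := by
  have hT := h.hT
  obtain ⟨e, hex, hey⟩ := exists_third hm x y
  exact h.decisive_trans (k := k + 420) hex.symm hxy hey subset_rfl
    (Finset.inter_subset_left.trans Finset.subset_union_left)
    (h.decisive_neutral hm hab hex.symm subset_rfl h₁) (h.decisive_neutral hm hab hey subset_rfl h₂)

/-- Another outcome would contradict agent i on some pair. The agents who side with i there form a
superset of {i}, which is decisive and forces the outcome to side with i as well. -/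
theorem ArrowContext.dictates (h : ArrowContext m n T Γ) (hm : 3 ≤ m) (hab : a ≠ b) {i : Fin n}
    (h₁ : Pr T Γ k (decisive {i} a b)) (R : Profile m n) :
    Pr T Γ (k + 500) (.var (R, R i)) := by
  have hT := h.hT
  have hs : (PForm.var (R, R i)).size ≤ T := by simp only [PForm.size]; omega
  refine h.total_elim (k := k + 496) R (fun π => ?_) hs
  have g := h.insert (.var (R, π))
  by_cases e : π = R i
  · rw [e]; exact (h.insert _).var_hyp (by simp)
  obtain ⟨x, y, hxy, h₂, h₃⟩ := exists_prefers_of_ne e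
  refine (g.aggPrefers_contra (k := k + 440) (R := R) (a := x) (b := y) ?_ ?_ hs).mono hT
    subset_rfl (by omega)
  · exact g.aggPrefers_of_decisive (k := k + 420) (S := Finset.univ.filter fun j => Prefers (R j) x y)
      hxy (fun j => by simp) (g.decisive_neutral hm hab hxy (by simpa using h₂)
        (h₁.mono hT (Set.subset_insert _ _) le_rfl))
  · exact (g.aggPrefers_intro (k := 0) h₃ (g.var_hyp (by simp))).mono hT subset_rfl (by omega)

theorem ArrowContext.decisive_singleton (h : ArrowContext m n T Γ) (hm : 3 ≤ m) (hab : a ≠ b)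
    {i : Fin n} (h₁ : Pr T Γ k (decisive {i} a b)) (hC : C.size ≤ T) :
    Pr T Γ (k + 520) C := by
  have hT := h.hT
  refine (h.clause_elim (k := k + 508) (.nondictatorial i) (fun l hl => ?_) hC).mono hT subset_rfl
    (by omega)
  simp only [Finset.mem_image, Finset.mem_univ, true_and] at hl
  obtain ⟨R, rfl⟩ := hl
  refine Pr.exfalso hT (c := k + 506) (Pr.absurd hT (A := .var (R, R i))
    ((h.dictates hm hab h₁ R).mono hT (Set.subset_insert _ _) le_rfl)
    ((Pr.hyp hT (by simp [Literal.toForm]) (by simp only [PForm.size]; omega)).mono hT subset_rfl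
      (Nat.zero_le _)) (by simp only [PForm.size]; omega)) hC

end Arrow

/-! ### Polynomial-size refutations of the Arrow formulas -/

section Refutation

variable {m n T k : ℕ} {Γ : Set (PForm (ArrowVar m n))} {a b : Fin m}

/-- The decisive coalitions form an ultrafilter: a decisive coalition remains decisive without the
agent `i`, unless `i` is a dictator. -/
theorem ArrowContext.not_decisive_insert (h : ArrowContext m n T Γ) (hm : 3 ≤ m) (hab : a ≠ b)
    (S : Finset (Fin n)) {i : Fin n} (hi : i ∉ S) :
    Pr T Γ 2000 ((decisive S a b).neg.imp (decisive (Insert.insert i S) a b).neg) := by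
  have hT := h.hT
  have hs : (PForm.falsum : PForm (ArrowVar m n)).size ≤ T := by simp only [PForm.size]; omega
  have hs' : 2 * (decisive S a b).size ≤ T := h.size_varDisj _
  have hneg : (decisive S a b).neg.size ≤ T := by simp only [PForm.size]; omega
  refine (Pr.deduction hT (c := 1900) (Pr.neg_intro hT (c := 1800) ?_ h.size_decisive.le |>.mono hT
    subset_rfl (by norm_num)) hneg).mono hT subset_rfl (by norm_num)
  have g := (h.insert (decisive S a b).neg).insert (decisive (Insert.insert i S) a b)
  refine (g.decisive_cases (k := 1500) S hab ?_ ?_ hs).mono hT subset_rfl (by norm_num)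
  · have g' := g.insert (decisive S a b)
    exact (Pr.absurd hT (g'.decisive_hyp (k := 0) (S := S) (a := a) (b := b) (by simp))
      (Pr.hyp hT (by simp) hneg) h.size_decisive.le).mono hT subset_rfl (by norm_num)
  -- The complement of S is decisive for b against a, by neutrality also for a against b, and it
  -- meets the enlarged coalition in i alone.
  · have g' := g.insert (decisive Sᶜ b a)
    have h₁ := g'.decisive_neutral (k := 0) hm hab.symm hab subset_rfl
      (g'.decisive_hyp (S := Sᶜ) (by simp))
    have h₂ := g'.decisive_hyp (k := 0 + 420) (S := Insert.insert i S) (a := a) (b := b) (by simp)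
    have h₃ := g'.decisive_inter hm hab hab h₂ h₁
    rw [show Insert.insert i S ∩ Sᶜ = {i} by
      ext j
      simp only [Finset.mem_inter, Finset.mem_insert, Finset.mem_compl, Finset.mem_singleton]
      constructor
      · tauto
      · rintro rfl; exact ⟨.inl rfl, hi⟩] at h₃
    exact (g'.decisive_singleton hm hab h₃ hs).mono hT subset_rfl (by norm_num)

/-- Each agent adds one implication and one modus ponens, so lines are counted additively. With
`Pr.mp` the exponent would grow with the number of agents. -/
theorem ArrowContext.not_decisive (h : ArrowContext m n T Γ) (hm : 3 ≤ m) (hab : a ≠ b)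
    (hk : 2000 ≤ k) (S : Finset (Fin n)) :
    Der Γ ((S.card + 1) * (2 * T ^ (k + 1))) (T ^ (k + 1)) (decisive S a b).neg := by
  have hT := h.hT
  have hpos : 1 ≤ T ^ (k + 1) := Nat.one_le_pow _ _ (by omega)
  induction S using Finset.induction_on with
  | empty =>
    have hs : (PForm.falsum : PForm (ArrowVar m n)).size ≤ T := by simp only [PForm.size]; omega
    have g := h.insert (decisive ∅ a b)
    have := Pr.neg_intro hT (g.decisive_empty (k := 0) hab (g.decisive_hyp (by simp)) hs)
      h.size_decisive.le
    exact Der.mono (this.mono hT subset_rfl (c' := k) (by omega)) subset_rfl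
      (by rw [Finset.card_empty]; omega) le_rfl
  | insert i S hi ih =>
    have step : Der Γ (T ^ (k + 1)) (T ^ (k + 1)) _ :=
      (h.not_decisive_insert hm hab S hi).mono hT subset_rfl hk
    refine (step.mp ih).mono subset_rfl ?_ le_rfl
    rw [Finset.card_insert_of_notMem hi]
    simp only [Nat.add_mul]
    omega

theorem lt_factorial_pow (hm : 2 ≤ m) (n : ℕ) : n < m.factorial ^ (n + 1) := by
  have h₁ : 2 ≤ m.factorial := hm.trans (Nat.self_le_factorial m)
  calc n < 2 ^ n := Nat.lt_two_pow_self
    _ ≤ m.factorial ^ n := Nat.pow_le_pow_left h₁ n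
    _ ≤ _ := Nat.pow_le_pow_right (by omega) (by omega)

theorem ArrowContext.refutation (h : ArrowContext m n T Γ) (hm : 3 ≤ m) :
    Pr T Γ 3000 .falsum := by
  have hT := h.hT
  let a : Fin m := ⟨0, by omega⟩
  let b : Fin m := ⟨1, by omega⟩
  have hab : a ≠ b := by simp [a, b]
  have h₂ : ∀ k, 2000 ≤ k → Pr T Γ (k + 2) (decisive Finset.univ a b).neg := by
    intro k hk
    refine (h.not_decisive hm hab hk Finset.univ).mono subset_rfl ?_
      (Nat.pow_le_pow_right (by omega) (by omega))
    rw [Finset.card_univ, Fintype.card_fin]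
    have h₃ := lt_factorial_pow (show 2 ≤ m by omega) n
    have h₄ := h.bound
    calc (n + 1) * (2 * T ^ (k + 1)) ≤ T * (T * T ^ (k + 1)) :=
          Nat.mul_le_mul (by omega) (Nat.mul_le_mul_right _ (by omega))
      _ = T ^ (k + 2 + 1) := by ring
  exact (Pr.absurd hT ((h.decisive_univ (k := 0) hab).mono hT subset_rfl (by norm_num))
    (h₂ 2000 le_rfl)
    h.size_decisive.le).mono hT subset_rfl (by norm_num)

end Refutation

/-! ### Total sizes of derivations -/

theorem derivationSize_le {V : Type} {d : List (PForm V)} {L b : ℕ} (hl : d.length ≤ L)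
    (hb : ∀ A ∈ d, A.size ≤ b) : derivationSize d ≤ L * b := by
  have h := List.sum_le_card_nsmul (d.map PForm.size) b (by simpa using hb)
  rw [List.length_map, smul_eq_mul] at h
  exact h.trans (Nat.mul_le_mul_right _ hl)

theorem derivationSize_append {V : Type} (d₁ d₂ : List (PForm V)) :
    derivationSize (d₁ ++ d₂) = derivationSize d₁ + derivationSize d₂ := by
  simp [derivationSize]

theorem Pr.exists_derivation {V : Type} {Γ : Set (PForm V)} {A : PForm V} {T c : ℕ}
    (h : Pr T Γ c A) : ∃ d, FregeDerivation Γ d ∧ A ∈ d ∧ derivationSize d ≤ T ^ (2 * (c + 1)) := by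
  obtain ⟨d, hd, hA, hl, hs⟩ := h
  refine ⟨d, hd, hA, (derivationSize_le hl hs).trans_eq ?_⟩
  rw [two_mul, ← pow_add]

theorem Pr.exists_derivation_forall {V X : Type} {Γ : Set (PForm V)} {T c : ℕ} (s : Finset X)
    (g : X → PForm V) (h : ∀ x ∈ s, Pr T Γ c (g x)) :
    ∃ d, FregeDerivation Γ d ∧ (∀ x ∈ s, g x ∈ d) ∧
      derivationSize d ≤ s.card * T ^ (2 * (c + 1)) := by
  classical
  induction s using Finset.induction_on with
  | empty => exact ⟨[], .nil, by simp, by simp [derivationSize]⟩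
  | insert x s hx ih =>
    obtain ⟨d, hd, hg, hs⟩ := ih fun y hy => h y (Finset.mem_insert_of_mem hy)
    obtain ⟨d', hd', hg', hs'⟩ := (h x (Finset.mem_insert_self _ _)).exists_derivation
    refine ⟨d' ++ d, hd'.append hd, fun y hy => ?_, ?_⟩
    · rcases Finset.mem_insert.1 hy with rfl | hy
      exacts [List.mem_append_left _ hg', List.mem_append_right _ (hg y hy)]
    · rw [derivationSize_append, Finset.card_insert_of_notMem hx, Nat.add_mul]
      omega

/-! ### Sizes of the Arrow formulas -/

theorem card_le_size_clause {V : Type} (c : Clause V) : c.card ≤ (Clause.toForm c).size := by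
  have key : ∀ l : List (PForm V), l.length ≤ (PForm.disj l).size := by
    intro l
    induction l with
    | nil => simp
    | cons A l ih => simp only [PForm.disj, PForm.size, List.length_cons]; omega
  have := key (c.toList.map Literal.toForm)
  rwa [List.length_map, Finset.length_toList] at this

/-- The totality clauses suffice: different profiles have different ones, each with m! literals. -/
theorem factorial_pow_le_size (m n : ℕ) : m.factorial ^ (n + 1) ≤ CNF.size (arrowFormula m n) := by
  classical
  let tot : Profile m n → Clause (ArrowVar m n) := fun R =>
    Finset.univ.image fun π : Ranking m => ((R, π), true)
  have hinj : Function.Injective tot := by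
    intro R R' hRR
    have : ((R, 1), true) ∈ tot R' := by rw [← hRR]; simp [tot]
    simp only [tot, Finset.mem_image, Finset.mem_univ, true_and, Prod.mk.injEq] at this
    obtain ⟨π, ⟨e, -⟩, -⟩ := this
    exact e.symm
  have hsub : Finset.univ.image tot ⊆ arrowFormula m n := by
    intro c hc
    obtain ⟨R, -, rfl⟩ := Finset.mem_image.1 hc
    simp only [arrowFormula, Finset.mem_filter, Finset.mem_univ, true_and]
    exact .total R
  have hcard : ∀ R, (tot R).card = m.factorial := by
    intro R
    rw [Finset.card_image_of_injective _ (fun π π' h => by simpa using h), Finset.card_univ,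
      Fintype.card_perm, Fintype.card_fin]
  calc m.factorial ^ (n + 1) = ∑ R : Profile m n, m.factorial := by
        simp [Fintype.card_perm, pow_succ]
    _ ≤ ∑ R : Profile m n, (Clause.toForm (tot R)).size :=
        Finset.sum_le_sum fun R _ => by rw [← hcard R]; exact card_le_size_clause _
    _ = ∑ c ∈ Finset.univ.image tot, (Clause.toForm c).size := by
        rw [Finset.sum_image fun R _ R' _ h => hinj h]
    _ ≤ CNF.size (arrowFormula m n) := Finset.sum_le_sum_of_subset hsub

/-- Clauses are indexed by profiles, by pairs of variables (uniqueness and independence), by agents,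
or by two objects and a profile. Each of these four index sets has at most M³ elements. -/
theorem card_arrowFormula_le {m : ℕ} (hm : 2 ≤ m) (n : ℕ) :
    (arrowFormula m n).card ≤ 4 * (m.factorial ^ (n + 1)) ^ 3 := by
  classical
  set M := m.factorial ^ (n + 1) with hM
  let g : Profile m n ⊕ (ArrowVar m n × ArrowVar m n) ⊕ Fin n ⊕ (Fin m × Fin m × Profile m n) →
      Clause (ArrowVar m n) := fun x => match x with
    | .inl R => Finset.univ.image fun π : Ranking m => ((R, π), true)
    | .inr (.inl (v, w)) => {(v, false), (w, false)}
    | .inr (.inr (.inl i)) => Finset.univ.image fun R : Profile m n => ((R, R i), false)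
    | .inr (.inr (.inr (a, b, R))) =>
      (Finset.univ.filter fun π : Ranking m => Prefers π a b).image fun π => ((R, π), true)
  have hsub : arrowFormula m n ⊆ Finset.univ.image g := by
    intro c hc
    simp only [arrowFormula, Finset.mem_filter, Finset.mem_univ, true_and] at hc
    rw [Finset.mem_image]
    cases hc with
    | total R => exact ⟨.inl R, by simp, rfl⟩
    | unique R π₁ π₂ _ => exact ⟨.inr (.inl ((R, π₁), (R, π₂))), by simp, rfl⟩
    | nondictatorial i => exact ⟨.inr (.inr (.inl i)), by simp, rfl⟩
    | unanimous a b R _ _ => exact ⟨.inr (.inr (.inr (a, b, R))), by simp, rfl⟩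
    | iia a b R R' π₁ π₂ _ _ => exact ⟨.inr (.inl ((R, π₁), (R', π₂))), by simp, rfl⟩
  have h₁ : (arrowFormula m n).card ≤ _ := (Finset.card_le_card hsub).trans Finset.card_image_le
  rw [Finset.card_univ] at h₁
  simp only [Fintype.card_sum, Fintype.card_prod (ArrowVar m n), card_arrowVar] at h₁
  simp only [Fintype.card_prod, Fintype.card_fin, Fintype.card_fun, Fintype.card_perm] at h₁
  rw [← hM] at h₁
  have hmm := Nat.self_le_factorial m
  have hn : n ≤ M := (lt_factorial_pow hm n).le
  have hK : m.factorial ^ n ≤ M := Nat.pow_le_pow_right m.factorial_pos (by omega)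
  have hm' : m ≤ M := hmm.trans (Nat.le_self_pow (by omega) _)
  have hM₁ : 1 ≤ M := Nat.one_le_pow _ _ m.factorial_pos
  have h₂ : m * (m * m.factorial ^ n) ≤ M * (M * M) :=
    Nat.mul_le_mul hm' (Nat.mul_le_mul hm' hK)
  have h₃ : M ^ 1 ≤ M ^ 3 := Nat.pow_le_pow_right hM₁ (by norm_num)
  have h₄ : M ^ 2 ≤ M ^ 3 := Nat.pow_le_pow_right hM₁ (by norm_num)
  have e₂ : M * (M * M) = M ^ 3 := by ring
  have e₄ : M * M = M ^ 2 := by ring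
  rw [pow_one] at h₃
  rw [e₂] at h₂
  rw [e₄] at h₁
  omega

theorem arrowFormula_hasFregeProof :
    ∃ E : ℕ, ∀ m n : ℕ, 3 ≤ m → HasFregeProofOfSize (arrowFormula m n)
      (((1000 * CNF.size (arrowFormula m n)) ^ E : ℕ) : ℝ) := by
  obtain ⟨c, hc⟩ : ∃ c, c = 3000 := ⟨_, rfl⟩
  refine ⟨2 * (c + 1), fun m n hm => ?_⟩
  have h : ArrowContext m n (1000 * m.factorial ^ (n + 1)) (CNF.forms (arrowFormula m n)) :=
    ⟨le_rfl, subset_rfl⟩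
  obtain ⟨d, hd, hf, hs⟩ := (hc ▸ h.refutation hm : Pr _ _ c _).exists_derivation
  refine ⟨d, hd, hf, Nat.cast_le.2 (hs.trans ?_)⟩
  exact Nat.pow_le_pow_left (Nat.mul_le_mul_left _ (factorial_pow_le_size m n)) _

/-! ### Soundness -/

/-- The truth of a formula under an assignment. -/
def PForm.Holds {V : Type} (v : V → Bool) : PForm V → Prop
  | .var x => v x = true
  | .falsum => False
  | .neg A => ¬ A.Holds v
  | .and A B => A.Holds v ∧ B.Holds v
  | .or A B => A.Holds v ∨ B.Holds v
  | .imp A B => A.Holds v → B.Holds v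

theorem FregeAxiom.holds {V : Type} {A : PForm V} (h : FregeAxiom A) (v : V → Bool) :
    A.Holds v := by
  cases h <;> simp only [PForm.Holds] <;> tauto

theorem FregeDerivation.holds {V : Type} {Γ : Set (PForm V)} {d : List (PForm V)}
    (h : FregeDerivation Γ d) (v : V → Bool) (hΓ : ∀ A ∈ Γ, A.Holds v) : ∀ A ∈ d, A.Holds v := by
  induction h with
  | nil => simp
  | ax _ hA ih => exact List.forall_mem_cons.2 ⟨hA.holds v, ih⟩
  | hyp _ hA ih => exact List.forall_mem_cons.2 ⟨hΓ _ hA, ih⟩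
  | mp _ h h' ih => exact List.forall_mem_cons.2 ⟨ih _ h (ih _ h'), ih⟩

theorem PForm.holds_disj {V : Type} {v : V → Bool} {l : List (PForm V)} {A : PForm V}
    (hA : A ∈ l) (h : A.Holds v) : (PForm.disj l).Holds v := by
  induction l with
  | nil => simp at hA
  | cons B l ih =>
    rcases List.mem_cons.1 hA with rfl | hA
    exacts [.inl h, .inr (ih hA)]

theorem HasFregeProofOfSize.not_satisfiable {V : Type} {Φ : CNF V} {s : ℝ}
    (h : HasFregeProofOfSize Φ s) : ¬ Φ.Satisfiable := by
  rintro ⟨v, hv⟩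
  obtain ⟨d, hd, hf, -⟩ := h
  refine hd.holds v ?_ _ hf
  rintro A ⟨c, hc, rfl⟩
  obtain ⟨l, hl, hvl⟩ := hv c hc
  refine PForm.holds_disj (List.mem_map.2 ⟨l, Finset.mem_toList.2 hl, rfl⟩) ?_
  unfold Literal.toForm
  split_ifs with h <;> simp [PForm.Holds, hvl, h]

/-- Arrow's theorem itself, read off from the Frege refutation by soundness. -/
theorem arrowFormula_not_satisfiable {m : ℕ} (hm : 3 ≤ m) (n : ℕ) :
    ¬ CNF.Satisfiable (arrowFormula m n) :=
  let ⟨_, hE⟩ := arrowFormula_hasFregeProof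
  (hE m n hm).not_satisfiable

/-! ### Simulating a society by a larger one -/

/-- A way to turn an aggregation rule for `m₁` objects and `n₁` agents into one for `m₂` objects and
`n₂` agents: the objects are embedded by `obj`, the agent `agent i` lends his ranking to `i`, and
the outcome is restricted to the embedded objects. -/
structure SocietyMap (m₁ n₁ m₂ n₂ : ℕ) where
  obj : Fin m₂ → Fin m₁
  obj_injective : Function.Injective obj
  agent : Fin n₁ → Fin n₂
  extend : Ranking m₂ → Ranking m₁
  extend_prefers : ∀ ρ a b, Prefers (extend ρ) (obj a) (obj b) ↔ Prefers ρ a b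
  restrict : Ranking m₁ → Ranking m₂
  restrict_prefers : ∀ π a b, Prefers (restrict π) a b ↔ Prefers π (obj a) (obj b)

namespace SocietyMap

variable {m₁ n₁ m₂ n₂ : ℕ} (s : SocietyMap m₁ n₁ m₂ n₂)

/-- The profile of the larger society induced by a profile of the smaller one. -/
def lift (R : Profile m₂ n₂) : Profile m₁ n₁ := fun i => s.extend (R (s.agent i))

theorem lift_prefers (R : Profile m₂ n₂) (i : Fin n₁) (a b : Fin m₂) :
    Prefers (s.lift R i) (s.obj a) (s.obj b) ↔ Prefers (R (s.agent i)) a b :=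
  s.extend_prefers _ a b

/-- The variables expressing that the induced profile is aggregated to an extension of a ranking. -/
def fiber (v : ArrowVar m₂ n₂) : Finset (ArrowVar m₁ n₁) :=
  Finset.univ.filter fun w => w.1 = s.lift v.1 ∧ s.restrict w.2 = v.2

/-- The substitution that defines the aggregation rule of the smaller society. -/
noncomputable def substitution (v : ArrowVar m₂ n₂) : PForm (ArrowVar m₁ n₁) := varDisj (s.fiber v)

theorem mem_fiber (R : Profile m₂ n₂) (π : Ranking m₁) :
    (s.lift R, π) ∈ s.fiber (R, s.restrict π) := by
  simp [fiber]

end SocietyMap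

theorem PForm.subst_disj {V W X : Type} (σ : V → PForm W) (f : X → PForm V) (l : List X) :
    (PForm.disj (l.map f)).subst σ = PForm.disj (l.map fun x => (f x).subst σ) := by
  induction l with
  | nil => rfl
  | cons x l ih => simp only [List.map_cons, PForm.disj, PForm.subst, ih]

theorem size_clause_subst_le {V W : Type} (c : Clause V) (σ : V → PForm W) (s : ℕ)
    (hs : ∀ v, (σ v).size ≤ s) : ((Clause.toForm c).subst σ).size ≤ (s + 2) * c.card + 1 := by
  unfold Clause.toForm
  rw [PForm.subst_disj, ← Finset.length_toList]
  refine size_disj_map_le _ (s + 1) _ fun l _ => ?_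
  have := hs l.1
  unfold Literal.toForm
  split_ifs <;> simp only [PForm.subst, PForm.size] <;> omega

theorem Pr.clause_subst_intro {V W : Type} {Γ : Set (PForm W)} {T k : ℕ} (hT : 100 ≤ T)
    {c : Clause V} {σ : V → PForm W} {l : Literal V} (hl : l ∈ c)
    (h : Pr T Γ k ((Literal.toForm l).subst σ)) (hs : ((Clause.toForm c).subst σ).size ≤ T) :
    Pr T Γ (k + 1) ((Clause.toForm c).subst σ) := by
  unfold Clause.toForm at *
  rw [PForm.subst_disj] at *
  exact Pr.disj_intro hT h (List.mem_map.2 ⟨l, Finset.mem_toList.2 hl, rfl⟩) hs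

section Simulation

variable {m₁ n₁ m₂ n₂ T k : ℕ} {Γ : Set (PForm (ArrowVar m₁ n₁))} (s : SocietyMap m₁ n₁ m₂ n₂)

theorem ArrowContext.substitution_intro (h : ArrowContext m₁ n₁ T Γ) {R : Profile m₂ n₂}
    {π : Ranking m₁} {c : Clause (ArrowVar m₂ n₂)} (hc : ((R, s.restrict π), true) ∈ c)
    (hs : ((Clause.toForm c).subst s.substitution).size < T)
    (h' : Pr T Γ k (.var (s.lift R, π))) :
    Pr T Γ (k + 2) ((Clause.toForm c).subst s.substitution) :=
  Pr.clause_subst_intro h.hT hc (h.varDisj_intro (s.mem_fiber R π) h') hs.le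

/-- If the substituted variable is false, its literal already proves the clause; so the variable may
be assumed true. -/
theorem ArrowContext.substitution_neg_intro (h : ArrowContext m₁ n₁ T Γ) {v : ArrowVar m₂ n₂}
    {c : Clause (ArrowVar m₂ n₂)} (hc : (v, false) ∈ c)
    (hs : ((Clause.toForm c).subst s.substitution).size < T)
    (h' : Pr T (Insert.insert (s.substitution v) Γ) k ((Clause.toForm c).subst s.substitution)) :
    Pr T Γ (k + 25) ((Clause.toForm c).subst s.substitution) := by
  have hT := h.hT
  have hv : 2 * (s.substitution v).size ≤ T := h.size_varDisj _
  refine (Pr.by_cases hT (c := k + 1) (s.substitution v) (h'.mono hT subset_rfl (by omega)) ?_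
    (by omega) hs).mono hT subset_rfl (by omega)
  exact (Pr.clause_subst_intro hT hc (σ := s.substitution) (Pr.hyp hT (by simp [Literal.toForm, PForm.subst])
    (show (s.substitution v).size + 1 ≤ T by omega))
    hs.le).mono hT subset_rfl (by omega)

theorem ArrowContext.substitution_hyp (h : ArrowContext m₁ n₁ T Γ) {v : ArrowVar m₂ n₂}
    (hv : s.substitution v ∈ Γ) : Pr T Γ k (s.substitution v) := by
  have hv' : 2 * (s.substitution v).size ≤ T := h.size_varDisj _
  exact (Pr.hyp h.hT hv (by omega)).mono h.hT subset_rfl (Nat.zero_le k)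

theorem ArrowContext.substitution_clash (h : ArrowContext m₁ n₁ T Γ) {v w : ArrowVar m₂ n₂}
    (hs : ((Clause.toForm {(v, false), (w, false)}).subst s.substitution).size < T)
    (hc : ∀ x ∈ s.fiber v, ∀ y ∈ s.fiber w, IsArrowClause m₁ n₁ {(x, false), (y, false)}) :
    Pr T Γ 100 ((Clause.toForm {(v, false), (w, false)}).subst s.substitution) := by
  have hT := h.hT
  refine (h.substitution_neg_intro s (v := v) (k := 70) (by simp) hs ?_).mono hT subset_rfl
    (by norm_num)
  have g := h.insert (s.substitution v)
  refine (g.substitution_neg_intro s (v := w) (k := 40) (by simp) hs ?_).mono hT subset_rfl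
    (by norm_num)
  have g' := g.insert (s.substitution w)
  refine (g'.varDisj_elim (k := 30) (s := s.fiber v) (g'.substitution_hyp s (by simp))
    (fun x hx => ?_) hs.le).mono hT subset_rfl (by norm_num)
  have g₁ := g'.insert (.var x)
  refine (g₁.varDisj_elim (k := 20) (s := s.fiber w) (g₁.substitution_hyp s (by simp))
    (fun y hy => ?_) hs.le).mono hT subset_rfl (by norm_num)
  have g₂ := g₁.insert (.var y)
  exact (g₂.clash (k := 0) (hc x hx y hy) (g₂.var_hyp (by simp)) (g₂.var_hyp (by simp))
    hs.le).mono hT subset_rfl (by norm_num)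

/-- Only non-dictatorship needs `hd`: a dictator j of the small society would make the agents
represented by j decisive in the large one. The other clauses follow from those of the same kind for
the lifted profiles. -/
theorem ArrowContext.simulation (h : ArrowContext m₁ n₁ T Γ) {a b : Fin m₂} (hab : a ≠ b)
    (hs : ∀ c, ((Clause.toForm c).subst s.substitution).size < T)
    (hd : ∀ j, Pr T (Insert.insert
      (decisive (Finset.univ.filter fun i => s.agent i = j) (s.obj a) (s.obj b)) Γ) k .falsum)
    {c : Clause (ArrowVar m₂ n₂)} (hc : IsArrowClause m₂ n₂ c) :
    Pr T Γ (k + 100) ((Clause.toForm c).subst s.substitution) := by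
  have hT := h.hT
  have hobj := s.obj_injective.ne hab
  have fiber_iff : ∀ {R ρ R' π}, (R', π) ∈ s.fiber (R, ρ) ↔ R' = s.lift R ∧ s.restrict π = ρ := by
    simp [SocietyMap.fiber]
  cases hc with
  | total R =>
    refine (h.total_elim (k := 2) (s.lift R) (fun π => ?_) (hs _).le).mono hT subset_rfl (by omega)
    exact (h.insert _).substitution_intro s (R := R) (π := π) (k := 0) (by simp) (hs _)
      ((h.insert _).var_hyp (by simp))
  | unique R π₁ π₂ hne =>
    refine (h.substitution_clash s (hs _) fun x hx y hy => ?_).mono hT subset_rfl (by omega)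
    obtain ⟨x₁, x₂⟩ := x
    obtain ⟨y₁, y₂⟩ := y
    rw [fiber_iff] at hx hy
    obtain ⟨rfl, rfl⟩ := hx
    obtain ⟨rfl, rfl⟩ := hy
    exact .unique _ _ _ fun e => hne (congrArg s.restrict e)
  | nondictatorial j =>
    -- In this profile j alone prefers a to b, so in the lifted one exactly the agents represented
    -- by j do. An outcome that follows j makes them decisive.
    let R : Profile m₂ n₂ := coalitionProfile {j} a b
    refine (h.substitution_neg_intro s (v := (R, R j)) (k := k + 60) ?_ (hs _) ?_).mono hT
      subset_rfl (by omega)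
    · exact Finset.mem_image.2 ⟨R, Finset.mem_univ _, rfl⟩
    have g := h.insert (s.substitution (R, R j))
    refine (g.varDisj_elim (k := k + 50) (s := s.fiber (R, R j)) (g.substitution_hyp s (by simp))
      (fun x hx => ?_) (hs _).le).mono hT subset_rfl (by omega)
    obtain ⟨x₁, π⟩ := x
    rw [fiber_iff] at hx
    obtain ⟨rfl, hπ⟩ := hx
    have g' := g.insert (.var (s.lift R, π))
    have hpref : Prefers π (s.obj a) (s.obj b) := by
      rw [← s.restrict_prefers, hπ]
      exact (coalitionProfile_prefers {j} hab j).2 (by simp)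
    have h₁ := g'.decisive_of_aggPrefers (S := Finset.univ.filter fun i => s.agent i = j) hobj
      (R := s.lift R) (fun i => by
        rw [s.lift_prefers, coalitionProfile_prefers {j} hab]; simp)
      (g'.aggPrefers_intro (k := 0) hpref (g'.var_hyp (by simp)))
    have h₂ := Pr.cut hT (c := k + 30) (h₁.mono hT subset_rfl (by omega))
      ((hd j).mono hT (Set.insert_subset_insert
        ((Set.subset_insert _ _).trans (Set.subset_insert _ _))) (by omega)) h.size_decisive.le
    exact (Pr.exfalso hT h₂ (hs _).le).mono hT subset_rfl (by omega)
  | unanimous x y R hxy hR =>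
    refine (h.clause_elim (k := 2) (.unanimous (s.obj x) (s.obj y) (s.lift R)
      (s.obj_injective.ne hxy) fun i => (s.lift_prefers R i x y).2 (hR _)) (fun l hl => ?_)
      (hs _).le).mono hT subset_rfl (by omega)
    simp only [Finset.mem_image, Finset.mem_filter, Finset.mem_univ, true_and] at hl
    obtain ⟨π, hπ, rfl⟩ := hl
    refine (h.insert _).substitution_intro s (R := R) (π := π) (k := 0) ?_ (hs _)
      ((h.insert _).var_hyp (by simp [Literal.toForm]))
    simpa [s.restrict_prefers] using hπ
  | iia x y R R' π₁ π₂ hR hπ =>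
    refine (h.substitution_clash s (hs _) fun v hv w hw => ?_).mono hT subset_rfl (by omega)
    obtain ⟨v₁, v₂⟩ := v
    obtain ⟨w₁, w₂⟩ := w
    rw [fiber_iff] at hv hw
    obtain ⟨rfl, rfl⟩ := hv
    obtain ⟨rfl, rfl⟩ := hw
    simp only [s.restrict_prefers] at hπ
    exact .iia (s.obj x) (s.obj y) _ _ _ _
      (fun i => by rw [s.lift_prefers, s.lift_prefers, hR]) hπ

/-- A clause has up to 2M literals and each is replaced by a disjunction of size up to 500M, so the
bound must be quadratic in M. -/
theorem SocietyMap.size_clause_subst_lt (hm : m₂ ≤ m₁) (hn : n₂ ≤ n₁)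
    (hT : (1000 * m₁.factorial ^ (n₁ + 1)) ^ 2 ≤ T) (c : Clause (ArrowVar m₂ n₂)) :
    ((Clause.toForm c).subst s.substitution).size < T := by
  set M := m₁.factorial ^ (n₁ + 1) with hM
  have h : ArrowContext m₁ n₁ (1000 * M) (CNF.forms (arrowFormula m₁ n₁)) := ⟨le_rfl, subset_rfl⟩
  have hv : ∀ v, (s.substitution v).size ≤ 500 * M := fun v => by
    have : 2 * (s.substitution v).size ≤ _ := h.size_varDisj _
    omega
  have h₁ := size_clause_subst_le c s.substitution _ hv
  have h₂ := Finset.card_le_univ c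
  rw [Fintype.card_prod, card_arrowVar, Fintype.card_bool] at h₂
  have h₃ : m₂.factorial ^ (n₂ + 1) ≤ M :=
    (Nat.pow_le_pow_left (Nat.factorial_le hm) _).trans
      (Nat.pow_le_pow_right m₁.factorial_pos (by omega))
  have hM₁ : 1 ≤ M := Nat.one_le_pow _ _ m₁.factorial_pos
  have h₄ : (500 * M + 2) * c.card ≤ (502 * M) * (2 * M) := Nat.mul_le_mul (by omega) (by omega)
  have e₁ : (502 * M) * (2 * M) = 1004 * (M * M) := by ring
  have e₂ : (1000 * M) ^ 2 = 1000000 * (M * M) := by ring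
  have h₅ : 1 ≤ M * M := Nat.mul_pos hM₁ hM₁
  omega

end Simulation

/-! ### The two simulations -/

/-- The ranking of the embedded objects that a ranking induces. -/
def inducedRanking {m₁ m₂ : ℕ} (f : Fin m₂ → Fin m₁) (π : Ranking m₁) : Ranking m₂ :=
  Tuple.sort fun a => π.symm (f a)

theorem inducedRanking_prefers {m₁ m₂ : ℕ} {f : Fin m₂ → Fin m₁} (hf : Function.Injective f)
    (π : Ranking m₁) (a b : Fin m₂) :
    Prefers (inducedRanking f π) a b ↔ Prefers π (f a) (f b) := by
  have hmono : StrictMono ((fun a => π.symm (f a)) ∘ inducedRanking f π) :=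
    (Tuple.monotone_sort fun a => π.symm (f a)).strictMono_of_injective
      ((π.symm.injective.comp hf).comp (inducedRanking f π).injective)
  have := hmono.lt_iff_lt (a := (inducedRanking f π).symm a) (b := (inducedRanking f π).symm b)
  simpa [Prefers] using this.symm

/-- The society that only ranks the first `m₂` objects. -/
def fewerObjects {m₁ m₂ : ℕ} (h : m₂ ≤ m₁) (n : ℕ) : SocietyMap m₁ n m₂ n where
  obj := Fin.castLE h
  obj_injective := Fin.castLE_injective h
  agent := id
  -- The embedded objects fill the first m₂ positions as in ρ, and the others stay in place.
  extend ρ := ρ.viaFintypeEmbedding ⟨Fin.castLE h, Fin.castLE_injective h⟩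
  extend_prefers ρ a b := by
    have key : ∀ a, (ρ.viaFintypeEmbedding ⟨Fin.castLE h, Fin.castLE_injective h⟩).symm
        (Fin.castLE h a) = Fin.castLE h (ρ.symm a) := fun a => by
      rw [Equiv.symm_apply_eq]
      have := ρ.viaFintypeEmbedding_apply_image ⟨Fin.castLE h, Fin.castLE_injective h⟩ (ρ.symm a)
      simp only [Function.Embedding.coeFn_mk, Equiv.apply_symm_apply] at this
      exact this.symm
    simp only [Prefers, key]
    exact Iff.rfl
  restrict := inducedRanking (Fin.castLE h)
  restrict_prefers := inducedRanking_prefers (Fin.castLE_injective h)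

/-- The society in which the agents `t` and `t + 1` vote as one. -/
def mergeAgents (m : ℕ) {n : ℕ} (t : ℕ) (ht : t + 1 < n) : SocietyMap m n m (n - 1) where
  obj := id
  obj_injective := Function.injective_id
  agent i := ⟨if (i : ℕ) ≤ t then i else i - 1, by split_ifs <;> omega⟩
  extend := id
  extend_prefers _ _ _ := Iff.rfl
  restrict := id
  restrict_prefers _ _ _ := Iff.rfl

theorem mergeAgents_fiber (m : ℕ) {n : ℕ} (t : ℕ) (ht : t + 1 < n) (j : Fin (n - 1)) :
    (∃ i, (Finset.univ.filter fun i => (mergeAgents m t ht).agent i = j) ⊆ {i}) ∨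
      (Finset.univ.filter fun i => (mergeAgents m t ht).agent i = j) ⊆
        {⟨t, by omega⟩, ⟨t + 1, ht⟩} := by
  by_contra! hno
  obtain ⟨h₁, h₂⟩ := hno
  -- A member outside the merged pair is alone in its fiber.
  obtain ⟨i, hi, hit⟩ := Finset.not_subset.1 h₂
  refine h₁ i fun i' hi' => ?_
  simp only [Finset.mem_filter, Finset.mem_univ, true_and, mergeAgents, Finset.mem_insert,
    Finset.mem_singleton, Fin.ext_iff] at hi hit hi' ⊢
  split_ifs at hi hi' <;> omega

/-- Each derivation has size at most T^(2(k+1)), there are at most T² clauses, and the last factor T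
absorbs the proof of the disjunction and the at most two cases. -/
theorem stepHasFregeProofs_of_pr {m₁ n₁ m₂ n₂ q r k T : ℕ} (hm₂ : 2 ≤ m₂) (hm : m₂ ≤ m₁)
    (hn : n₂ ≤ n₁) (hqr : q ≤ r) (hq : q ≤ 2) (hT : (1000 * m₁.factorial ^ (n₁ + 1)) ^ 2 = T)
    (Ξ : Fin q → PForm (ArrowVar m₁ n₁)) (s : Fin q → SocietyMap m₁ n₁ m₂ n₂)
    (h₀ : Pr T ∅ k (PForm.disj (List.ofFn Ξ)))
    (h₁ : ∀ t, ∀ c, IsArrowClause m₂ n₂ c →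
      Pr T (CNF.forms (arrowFormula m₁ n₁) ∪ {Ξ t}) k
        ((Clause.toForm c).subst (s t).substitution)) :
    StepHasFregeProofs (arrowFormula m₁ n₁) (arrowFormula m₂ n₂) r (T ^ (2 * (k + 1) + 3)) := by
  obtain ⟨d₀, hd₀, hΞ, hs₀⟩ := h₀.exists_derivation
  have key := fun t => Pr.exists_derivation_forall (arrowFormula m₂ n₂)
    (fun c => (Clause.toForm c).subst (s t).substitution)
    (fun c hc => h₁ t c (by simpa [arrowFormula] using hc))
  choose d hd hcd hsd using key
  refine ⟨q, hqr, Ξ, fun t => (s t).substitution, d₀, d, hd₀, hΞ, fun t => ⟨hd t, hcd t⟩, ?_⟩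
  have hcard := card_arrowFormula_le hm₂ n₂
  have hM : m₂.factorial ^ (n₂ + 1) ≤ m₁.factorial ^ (n₁ + 1) :=
    (Nat.pow_le_pow_left (Nat.factorial_le hm) _).trans
      (Nat.pow_le_pow_right m₁.factorial_pos (by omega))
  set M := m₁.factorial ^ (n₁ + 1)
  have hM₁ : 1 ≤ M := Nat.one_le_pow _ _ m₁.factorial_pos
  have hcard' : (arrowFormula m₂ n₂).card ≤ T ^ 2 :=
    calc (arrowFormula m₂ n₂).card ≤ 4 * (m₂.factorial ^ (n₂ + 1)) ^ 3 := hcard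
      _ ≤ 4 * M ^ 3 := Nat.mul_le_mul_left _ (Nat.pow_le_pow_left hM 3)
      _ ≤ 1000 ^ 4 * M ^ 4 := Nat.mul_le_mul (by norm_num)
          (Nat.pow_le_pow_right hM₁ (by norm_num))
      _ = T ^ 2 := by rw [← hT]; ring
  have hT₁ : 3 ≤ T := by
    have : 1 ≤ M ^ 2 := Nat.one_le_pow _ _ hM₁
    rw [← hT, mul_pow]
    omega
  set Q := T ^ (2 * (k + 1))
  have hsum : ∑ t, derivationSize (d t) ≤ 2 * (T ^ 2 * Q) := by
    calc ∑ t, derivationSize (d t) ≤ ∑ _t : Fin q, T ^ 2 * Q :=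
          Finset.sum_le_sum fun t _ => (hsd t).trans (Nat.mul_le_mul_right _ hcard')
      _ = q * (T ^ 2 * Q) := by simp
      _ ≤ 2 * (T ^ 2 * Q) := Nat.mul_le_mul_right _ hq
  have hQ : Q ≤ T ^ 2 * Q := Nat.le_mul_of_pos_left _ (by positivity)
  calc derivationSize d₀ + ∑ t, derivationSize (d t) ≤ 3 * (T ^ 2 * Q) := by omega
    _ ≤ T * (T ^ 2 * Q) := Nat.mul_le_mul_right _ hT₁
    _ = T ^ (2 * (k + 1) + 3) := by simp only [Q]; ring

theorem arrowContext_union (m n : ℕ) (Ξ : PForm (ArrowVar m n)) :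
    ArrowContext m n ((1000 * m.factorial ^ (n + 1)) ^ 2)
      (CNF.forms (arrowFormula m n) ∪ {Ξ}) :=
  ⟨Nat.le_self_pow (by norm_num) _, Set.subset_union_left⟩

/-- Reducing the number of objects: the substitution restricts the outcome to the first objects. A
dictator over these is decisive on one pair of objects, hence a dictator over all of them. -/
theorem fewerObjects_step {m₁ m₂ k : ℕ} (hm₂ : 3 ≤ m₂) (hm : m₂ ≤ m₁) (n : ℕ) (hk : 2000 ≤ k) :
    StepHasFregeProofs (arrowFormula m₁ n) (arrowFormula m₂ n) 1
      (((1000 * m₁.factorial ^ (n + 1)) ^ 2) ^ (2 * (k + 1) + 3)) := by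
  have hT := (arrowContext_union m₁ n .falsum).hT
  have hab : (⟨0, by omega⟩ : Fin m₂) ≠ ⟨1, by omega⟩ := by simp
  refine stepHasFregeProofs_of_pr (q := 1) (by omega) hm le_rfl le_rfl (by norm_num) rfl
    -- There is only one case, so its condition is a tautology.
    (fun _ => PForm.falsum.imp .falsum) (fun _ => fewerObjects hm n) ?_ fun t c hc => ?_
  · refine (Pr.disj_intro hT (c := 1) (A := PForm.falsum.imp .falsum)
      (Pr.ax hT (.falsum_elim _) (by simp only [PForm.size]; omega)) (by simp) ?_).mono hT
      subset_rfl (by omega)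
    simp only [List.ofFn_succ, List.ofFn_zero, PForm.disj, PForm.size]
    omega
  · have h := arrowContext_union m₁ n (PForm.falsum.imp .falsum)
    refine (h.simulation (k := 600) (fewerObjects hm n) hab
      (SocietyMap.size_clause_subst_lt _ hm le_rfl le_rfl) (fun j => ?_) hc).mono hT subset_rfl
      (by omega)
    have e : (Finset.univ.filter fun i => (fewerObjects hm n).agent i = j) = {j} := by
      ext i
      rw [Finset.mem_filter, Finset.mem_singleton]
      exact ⟨fun h => h.2, fun h => ⟨Finset.mem_univ _, h⟩⟩
    rw [e]
    refine ((h.insert _).decisive_singleton (k := 0) (by omega)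
      ((fewerObjects hm n).obj_injective.ne hab) ((h.insert _).decisive_hyp (S := {j}) (by simp))
      ?_).mono hT subset_rfl (by omega)
    simp only [PForm.size]
    omega

theorem ArrowContext.mergeAgents_clause {m n T : ℕ} {Γ : Set (PForm (ArrowVar m n))}
    (h : ArrowContext m n T Γ) (hm : 3 ≤ m) {a b : Fin m} (hab : a ≠ b) (t : ℕ) (ht : t + 1 < n)
    (hs : ∀ c, ((Clause.toForm c).subst (mergeAgents m t ht).substitution).size < T)
    (hd : ∀ Δ, Γ ⊆ Δ → Pr T Δ 420 (decisive {⟨t, by omega⟩, ⟨t + 1, ht⟩} a b) →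
      Pr T Δ 1900 .falsum)
    {c : Clause (ArrowVar m (n - 1))} (hc : IsArrowClause m (n - 1) c) :
    Pr T Γ 2000 ((Clause.toForm c).subst (mergeAgents m t ht).substitution) := by
  have hT := h.hT
  refine h.simulation (k := 1900) (mergeAgents m t ht) hab hs (fun j => ?_) hc
  have g := h.insert (decisive (Finset.univ.filter fun i => (mergeAgents m t ht).agent i = j) a b)
  have hyp := g.decisive_hyp (k := 0)
    (S := Finset.univ.filter fun i => (mergeAgents m t ht).agent i = j) (a := a) (b := b)
    (Set.mem_insert _ _)
  rcases mergeAgents_fiber m t ht j with ⟨i, hi⟩ | hi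
  · exact (g.decisive_singleton hm hab (g.decisive_neutral hm hab hab hi hyp)
      (by simp only [PForm.size]; omega)).mono hT subset_rfl (by omega)
  · exact hd _ (Set.subset_insert _ _) ((g.decisive_neutral hm hab hab hi hyp).mono hT subset_rfl
      (by omega))

/-- Removing an agent: if the agents `0` and `1` are not decisive together, then they can vote as
one. Otherwise the agents `1` and `2` can, since if they were decisive as well, then the agent `1`
would be a dictator. -/
theorem mergeAgents_step {m n k : ℕ} (hm : 3 ≤ m) (hn : 3 ≤ n) (hk : 2000 ≤ k) :
    StepHasFregeProofs (arrowFormula m n) (arrowFormula m (n - 1)) 2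
      (((1000 * m.factorial ^ (n + 1)) ^ 2) ^ (2 * (k + 1) + 3)) := by
  have hT := (arrowContext_union m n .falsum).hT
  let a : Fin m := ⟨0, by omega⟩
  let b : Fin m := ⟨1, by omega⟩
  have hab : a ≠ b := by simp [a, b]
  let D : PForm (ArrowVar m n) := decisive {⟨0, by omega⟩, ⟨1, by omega⟩} a b
  -- The bound before squaring leaves room for the disjunction of D and its negation.
  have hD : 2 * D.size ≤ 1000 * m.factorial ^ (n + 1) :=
    (⟨le_rfl, subset_rfl⟩ : ArrowContext m n (1000 * m.factorial ^ (n + 1))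
      (CNF.forms (arrowFormula m n))).size_varDisj _
  have hM : 1 ≤ m.factorial ^ (n + 1) := Nat.one_le_pow _ _ m.factorial_pos
  have hT' : 10 * (1000 * m.factorial ^ (n + 1)) ≤ (1000 * m.factorial ^ (n + 1)) ^ 2 := by
    rw [pow_two]
    exact Nat.mul_le_mul_right _ (by omega)
  have hfalse : (PForm.falsum : PForm (ArrowVar m n)).size ≤ (1000 * m.factorial ^ (n + 1)) ^ 2 := by
    simp only [PForm.size]; omega
  refine stepHasFregeProofs_of_pr (q := 2) (by omega) le_rfl (by omega) le_rfl le_rfl rfl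
    ![D.neg, D] ![mergeAgents m 0 (by omega), mergeAgents m 1 (by omega)] ?_ ?_
  · have e : List.ofFn ![D.neg, D] = [D.neg, D] := by simp [List.ofFn_succ]
    have hs : (PForm.disj [D.neg, D]).size < (1000 * m.factorial ^ (n + 1)) ^ 2 := by
      simp only [PForm.disj, PForm.size]; omega
    rw [e]
    refine (Pr.by_cases hT (c := 1) D ?_ ?_ (by omega) hs).mono hT subset_rfl (by omega)
    · exact Pr.disj_intro hT (c := 0) (A := D) (Pr.hyp hT (by simp) (by omega)) (by simp) hs.le
    · exact Pr.disj_intro hT (c := 0) (A := D.neg) (Pr.hyp hT (by simp)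
        (by simp only [PForm.size]; omega)) (by simp) hs.le
  · have hsize : ∀ t (ht : t + 1 < n) c, _ := fun t ht =>
      SocietyMap.size_clause_subst_lt (mergeAgents m t ht) le_rfl (by omega) le_rfl
    have g := arrowContext_union m n D.neg
    have g' := arrowContext_union m n D
    have hDneg : D.neg.size ≤ (1000 * m.factorial ^ (n + 1)) ^ 2 := by
      simp only [PForm.size]; omega
    refine Fin.forall_fin_two.2 ⟨fun c hc => ?_, fun c hc => ?_⟩
    · exact (g.mergeAgents_clause hm hab 0 (by omega) (hsize 0 _) (fun Δ hΔ h₁ =>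
        (Pr.absurd hT h₁ ((Pr.hyp hT (hΔ (.inr rfl)) hDneg).mono hT subset_rfl
          (Nat.zero_le _)) g.size_decisive.le).mono hT subset_rfl (by omega)) hc).mono hT subset_rfl hk
    · refine (g'.mergeAgents_clause hm hab 1 (by omega) (hsize 1 _) (fun Δ hΔ h₁ => ?_)
        hc).mono hT subset_rfl hk
      have h := g'.mono hΔ
      have h₂ := h.decisive_hyp (k := 420) (hΔ (.inr rfl) : D ∈ Δ)
      have h₃ := h.decisive_inter hm hab hab h₂ h₁
      refine (h.decisive_singleton hm hab (i := ⟨1, by omega⟩) (h.decisive_neutral hm hab hab ?_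
        h₃) hfalse).mono hT subset_rfl (by omega)
      intro i hi
      simp only [Finset.mem_inter, Finset.mem_insert, Finset.mem_singleton, Fin.ext_iff] at hi ⊢
      omega

/-! ### Reduction chains -/

theorem not_mem_arrowProblem {p : List Unit × ℕ} (hp : 3 ≤ p.1.length) : p ∉ arrowProblem :=
  arrowFormula_not_satisfiable hp p.2

theorem reduceObjects_of_le {p : List Unit × ℕ} (h : 6 ≤ p.1.length) :
    reduceObjects p = (List.replicate 5 (), p.2) :=
  if_pos h

theorem removeAgent_of_le {p : List Unit × ℕ} (h : 3 ≤ p.1.length ∧ 3 ≤ p.2) :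
    removeAgent p = (p.1, p.2 - 1) :=
  if_pos h

theorem reduceObjects_ne {p : List Unit × ℕ} (h : reduceObjects p ≠ p) : 6 ≤ p.1.length :=
  not_lt.1 fun hlt => h (if_neg (not_le.2 hlt))

theorem removeAgent_ne {p : List Unit × ℕ} (h : removeAgent p ≠ p) :
    3 ≤ p.1.length ∧ 3 ≤ p.2 :=
  not_not.1 fun hn => h (if_neg hn)

theorem rule_cases {A : List Unit × ℕ → List Unit × ℕ} (hA : A ∈ [reduceObjects, removeAgent])
    {p : List Unit × ℕ} (hp : A p ≠ p) :
    (6 ≤ p.1.length ∧ A p = (List.replicate 5 (), p.2)) ∨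
      (3 ≤ p.1.length ∧ 3 ≤ p.2 ∧ A p = (p.1, p.2 - 1)) := by
  simp only [List.mem_cons, List.not_mem_nil, or_false] at hA
  rcases hA with rfl | rfl
  · exact .inl ⟨reduceObjects_ne hp, reduceObjects_of_le (reduceObjects_ne hp)⟩
  · exact .inr ⟨(removeAgent_ne hp).1, (removeAgent_ne hp).2, removeAgent_of_le (removeAgent_ne hp)⟩

theorem isDataReductionRule_reduceObjects : IsDataReductionRule arrowProblem reduceObjects where
  polyTime := polyTimeMap_reduceObjects
  safe p := by
    by_cases h : 6 ≤ p.1.length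
    · refine iff_of_false (not_mem_arrowProblem (by omega)) (not_mem_arrowProblem ?_)
      rw [reduceObjects_of_le h]
      simp
    · rw [reduceObjects, if_neg h]
  length_le p := by
    unfold reduceObjects
    split_ifs with h
    · rw [List.length_replicate]; omega
    · exact le_rfl

theorem isDataReductionRule_removeAgent : IsDataReductionRule arrowProblem removeAgent where
  polyTime := polyTimeMap_removeAgent
  safe p := by
    by_cases h : 3 ≤ p.1.length ∧ 3 ≤ p.2
    · refine iff_of_false (not_mem_arrowProblem h.1) (not_mem_arrowProblem ?_)
      rw [removeAgent_of_le h]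
      exact h.1
    · rw [removeAgent, if_neg h]
  length_le p := by
    unfold removeAgent
    split_ifs <;> exact le_rfl

theorem isKernelization_arrowKernel : IsKernelization arrowProblem arrowKernel where
  polyTime := polyTimeMap_arrowKernel
  safe p := by
    by_cases h : 3 ≤ p.1.length
    · refine iff_of_false (not_mem_arrowProblem h) (not_mem_arrowProblem ?_)
      rw [arrowKernel, if_pos h, List.length_replicate]
      omega
    · rw [arrowKernel, if_neg h]
  kernel_size := by
    refine ⟨fun n => n + 5, ?_, fun p => ?_⟩
    · exact (Primrec.nat_add.comp Primrec.id (Primrec.const 5)).to_comp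
    · unfold arrowKernel
      split_ifs with h
      · simp only [List.length_replicate]; omega
      · constructor <;> dsimp only <;> omega

/-- An upper bound for the number of steps that remain. -/
def remainingSteps (p : List Unit × ℕ) : ℕ := p.2 + if 6 ≤ p.1.length then 1 else 0

theorem remainingSteps_lt {A : List Unit × ℕ → List Unit × ℕ}
    (hA : A ∈ [reduceObjects, removeAgent]) {p : List Unit × ℕ} (hp : A p ≠ p) :
    remainingSteps (A p) < remainingSteps p := by
  rcases rule_cases hA hp with ⟨h, e⟩ | ⟨h, h', e⟩ <;> rw [e] <;> unfold remainingSteps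
  · simp [h]
  · simp only
    split_ifs <;> omega

theorem IsReductionChain.step_eq {p : List Unit × ℕ} {l : ℕ} {s : ℕ → List Unit × ℕ}
    (h : IsReductionChain [reduceObjects, removeAgent] p l s) {i : ℕ} (hi : i < l) :
    ∃ A ∈ [reduceObjects, removeAgent], s (i + 1) = A (s i) ∧ A (s i) ≠ s i := by
  obtain ⟨hne, A, hA, e⟩ := h.step i hi
  exact ⟨A, hA, e, e ▸ hne⟩

theorem IsReductionChain.length_le {p : List Unit × ℕ} {l : ℕ} {s : ℕ → List Unit × ℕ}
    (h : IsReductionChain [reduceObjects, removeAgent] p l s) : l ≤ p.2 + 1 := by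
  have key : ∀ i ≤ l, remainingSteps (s i) + i ≤ remainingSteps p := by
    intro i
    induction i with
    | zero => intro _; rw [h.initial]; omega
    | succ i ih =>
      intro hi
      obtain ⟨A, hA, e, hne⟩ := h.step_eq (show i < l by omega)
      have h₁ := remainingSteps_lt hA hne
      have h₂ := ih (by omega)
      rw [e]
      omega
  have h₁ := key l le_rfl
  have h₂ : remainingSteps p ≤ p.2 + 1 := by
    unfold remainingSteps
    split_ifs <;> omega
  omega

theorem IsReductionChain.le_initial {p : List Unit × ℕ} {l : ℕ} {s : ℕ → List Unit × ℕ}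
    (h : IsReductionChain [reduceObjects, removeAgent] p l s) :
    ∀ i ≤ l, (s i).1.length ≤ p.1.length ∧ (s i).2 ≤ p.2 := by
  intro i
  induction i with
  | zero => intro _; rw [h.initial]; exact ⟨le_rfl, le_rfl⟩
  | succ i ih =>
    intro hi
    obtain ⟨A, hA, e, hne⟩ := h.step_eq (show i < l by omega)
    obtain ⟨h₁, h₂⟩ := ih (by omega)
    rw [e]
    rcases rule_cases hA hne with ⟨h₃, e'⟩ | ⟨h₃, h₄, e'⟩ <;> rw [e']
    · simp only [List.length_replicate]; omega
    · simp only; omega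

/-- With invariance under the rules and the identity on fixed instances, the end of every chain is
the kernel. -/
theorem arrowKernel_rule {A : List Unit × ℕ → List Unit × ℕ}
    (hA : A ∈ [reduceObjects, removeAgent]) {p : List Unit × ℕ} (hp : A p ≠ p) :
    arrowKernel (A p) = arrowKernel p := by
  rcases rule_cases hA hp with ⟨h, e⟩ | ⟨h, h', e⟩ <;> rw [e] <;> unfold arrowKernel
  · simp only [List.length_replicate]
    rw [if_pos (by norm_num), if_pos (by omega), min_self,
      show min p.1.length 5 = 5 by omega]
  · simp only
    rw [if_pos h, if_pos h]
    congr 1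
    omega

theorem arrowKernel_of_fixed {p : List Unit × ℕ} (h₁ : reduceObjects p = p)
    (h₂ : removeAgent p = p) : arrowKernel p = p := by
  obtain ⟨w, n⟩ := p
  have hw : w = List.replicate w.length () := by rw [List.eq_replicate_iff]; simp
  unfold arrowKernel
  split_ifs with h
  · have hm : w.length ≤ 5 := by
      by_contra hn
      rw [reduceObjects_of_le (by simp only; omega)] at h₁
      have := congrArg (fun q : List Unit × ℕ => q.1.length) h₁
      simp only [List.length_replicate] at this
      omega
    have hn : n ≤ 2 := by
      by_contra hn
      rw [removeAgent_of_le ⟨h, by simp only; omega⟩] at h₂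
      have := congrArg Prod.snd h₂
      simp only at this
      omega
    simp only
    rw [min_eq_left hm, min_eq_left hn, ← hw]
  · rfl

theorem exists_chain_arrowKernel (p : List Unit × ℕ) :
    ∃ l s, IsReductionChain [reduceObjects, removeAgent] p l s ∧ s l = arrowKernel p := by
  induction hk : remainingSteps p using Nat.strong_induction_on generalizing p with
  | _ k ih =>
    by_cases hfix : ∀ A ∈ [reduceObjects, removeAgent], A p = p
    · exact ⟨0, fun _ => p, ⟨rfl, by simp, hfix⟩,
        (arrowKernel_of_fixed (hfix _ (by simp)) (hfix _ (by simp))).symm⟩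
    · push Not at hfix
      obtain ⟨A, hA, hne⟩ := hfix
      obtain ⟨l, s, hs, e⟩ := ih _ (hk ▸ remainingSteps_lt hA hne) (A p) rfl
      refine ⟨l + 1, fun i => i.casesOn p s, ⟨rfl, fun i hi => ?_, hs.final⟩,
        e.trans (arrowKernel_rule hA hne)⟩
      cases i with
      | zero =>
        simp only [hs.initial]
        exact ⟨hne, A, hA, rfl⟩
      | succ i => exact hs.step i (by omega)

/-! ### Polynomial and quasipolynomial bounds -/

theorem StepHasFregeProofs.mono {V W : Type} {Φ₁ : CNF V} {Φ₂ : CNF W} {r r' S S' : ℕ}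
    (h : StepHasFregeProofs Φ₁ Φ₂ r S) (hr : r ≤ r') (hS : S ≤ S') :
    StepHasFregeProofs Φ₁ Φ₂ r' S' := by
  obtain ⟨q, hq, Ξ, σ, d₀, d, h₁, h₂, h₃, h₄⟩ := h
  exact ⟨q, hq.trans hr, Ξ, σ, d₀, d, h₁, h₂, h₃, h₄.trans hS⟩

theorem exists_stepHasFregeProofs :
    ∃ E : ℕ, ∀ A ∈ [reduceObjects, removeAgent], ∀ p : List Unit × ℕ, A p ≠ p →
      StepHasFregeProofs (arrowTranslation p) (arrowTranslation (A p)) 2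
        ((1000 * p.1.length.factorial ^ (p.2 + 1)) ^ E) := by
  obtain ⟨k, hk⟩ : ∃ k, 2000 ≤ k := ⟨_, le_rfl⟩
  refine ⟨2 * (2 * (k + 1) + 3), fun A hA p hp => ?_⟩
  rw [pow_mul]
  rcases rule_cases hA hp with ⟨h, e⟩ | ⟨h, h', e⟩ <;> rw [e]
  · exact (fewerObjects_step (m₂ := 5) (by norm_num) (by omega) p.2 hk).mono (by norm_num) le_rfl
  · exact mergeAgents_step h h' hk

theorem exists_soundnessHasFregeProofs :
    ∃ h : Polynomial ℕ, ∀ A ∈ [reduceObjects, removeAgent],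
      SoundnessHasFregeProofs arrowProblem arrowTranslation [reduceObjects, removeAgent] A
        (fun N => h.eval N) := by
  obtain ⟨E, hE⟩ := exists_stepHasFregeProofs
  refine ⟨(Polynomial.C 1000 * Polynomial.X) ^ E, fun A hA => ⟨2, by norm_num, ?_⟩⟩
  intro p _ l s hs i hi e
  have hne : A (s i) ≠ s i := e ▸ (hs.step i hi).1
  rw [e]
  refine (hE A hA (s i) hne).mono le_rfl ?_
  -- Neither m nor n grows along a chain, so each step is bounded by the size of the initial
  -- formula.
  obtain ⟨h₁, h₂⟩ := hs.le_initial i hi.le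
  simp only [Polynomial.eval_pow, Polynomial.eval_mul, Polynomial.eval_C, Polynomial.eval_X]
  refine Nat.pow_le_pow_left (Nat.mul_le_mul_left _ ?_) _
  calc (s i).1.length.factorial ^ ((s i).2 + 1) ≤ p.1.length.factorial ^ ((s i).2 + 1) :=
        Nat.pow_le_pow_left (Nat.factorial_le h₁) _
    _ ≤ p.1.length.factorial ^ (p.2 + 1) :=
        Nat.pow_le_pow_right (Nat.factorial_pos _) (by omega)
    _ ≤ CNF.size (arrowTranslation p) := factorial_pow_le_size _ _

/-- With exponent 1 and c = E / log 2 the bounding function is N^E. -/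
theorem isQuasipolynomial_pow (E : ℕ) :
    IsQuasipolynomial fun N => (((1000 * N) ^ E : ℕ) : ℝ) := by
  refine ⟨1, E / Real.log 2, one_pos, ?_⟩
  refine Asymptotics.IsBigO.of_bound (1000 ^ E) ?_
  filter_upwards [Filter.eventually_ge_atTop 1] with N hN
  have hN' : (0 : ℝ) < N := by exact_mod_cast hN
  have h2 : Real.log 2 ≠ 0 := (Real.log_pos one_lt_two).ne'
  have e : (2 : ℝ) ^ (E / Real.log 2 * Real.log N ^ 1) = (N : ℝ) ^ E := by
    rw [Real.rpow_def_of_pos two_pos, pow_one, ← Real.rpow_natCast, Real.rpow_def_of_pos hN']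
    congr 1
    field_simp
  rw [e, Real.norm_of_nonneg (by positivity), Real.norm_of_nonneg (by positivity)]
  push_cast
  rw [mul_pow]

end FregeArrow

theorem mainTheorem3 :
    -- the two rules give a kernelization, and all reduction chains have length at most `C (n + 1)`
    (∃ Ker : List Unit × ℕ → List Unit × ℕ,
      IsKernelizationVia arrowProblem [reduceObjects, removeAgent] Ker) ∧
    (∃ C : ℕ, ∀ (p : List Unit × ℕ) (l : ℕ) (s : ℕ → List Unit × ℕ),
      IsReductionChain [reduceObjects, removeAgent] p l s → l ≤ C * (p.2 + 1)) ∧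
    -- the steps are witnessed by polynomial-size Frege proofs
    (∃ h : Polynomial ℕ, ∀ A ∈ [reduceObjects, removeAgent],
      SoundnessHasFregeProofs arrowProblem arrowTranslation [reduceObjects, removeAgent] A
        (fun N => h.eval N)) ∧
    -- quasipolynomial-size Frege proofs
    (∃ f : ℕ → ℝ, IsQuasipolynomial f ∧ ∀ m n : ℕ, 3 ≤ m → 3 ≤ n →
      HasFregeProofOfSize (arrowFormula m n) (f (CNF.size (arrowFormula m n)))) ∧
    -- polynomial-size Frege proofs for each fixed number of agents
    (∀ n : ℕ, 3 ≤ n → ∃ q : Polynomial ℕ, ∀ m : ℕ, 3 ≤ m →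
      HasFregeProofOfSize (arrowFormula m n)
        ((q.eval (CNF.size (arrowFormula m n)) : ℕ) : ℝ)) := by
  obtain ⟨E, hE⟩ := arrowFormula_hasFregeProof
  refine ⟨⟨arrowKernel, ?_, isKernelization_arrowKernel, exists_chain_arrowKernel⟩,
    ⟨1, fun p l s hs => by rw [one_mul]; exact hs.length_le⟩, exists_soundnessHasFregeProofs,
    ⟨_, isQuasipolynomial_pow E, fun m n hm _ => hE m n hm⟩,
    fun n _ => ⟨(Polynomial.C 1000 * Polynomial.X) ^ E, fun m hm => ?_⟩⟩
  · simp only [List.forall_mem_cons, List.not_mem_nil, false_implies, implies_true, and_true]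
    exact ⟨isDataReductionRule_reduceObjects, isDataReductionRule_removeAgent⟩
  · simpa only [Polynomial.eval_pow, Polynomial.eval_mul, Polynomial.eval_C, Polynomial.eval_X]
      using hE m n hm
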